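/- Let $k\ge 2$ be an integer. For all sufficiently smooth functions $c,f$ on $[0,1]$ (that is, of class $C^m([0,1])$ for some $m$ depending only on $k$) with $c>1$ on $[0,1]$, and for every $\alpha>0$, there is a constant $C$, depending only on $k,c,f,\alpha$, such that the following holds. Let $\varepsilon>0$ be such that $\tau:=\varepsilon^{(k-1)/k}<\tfrac12$, and let $u\in C^2([0,1])$ solve $$-\varepsilon^2u''+cu=f\ \text{ in }(0,1),\qquad u'(0)=u'(1)=0 .$$ Consider a mesh on $[0,1]$ that is equidistant in each of the three subintervals $[0,\tau]$, $[\tau,1-\tau]$ and $[1-\tau,1]$, with $N\ge1$ cells, of size $h=\tau/N$, in each of the two layer regions $[0,\tau]$ and $[1-\tau,1]$, and $M\ge1$ cells in $[\tau,1-\tau]$. Let $H>0$ be such that $h\le\alpha H\varepsilon^{(k-1)/k}$ and the mesh size in $[\tau,1-\tau]$ is at most $H$. Let $V_h$ be the space of continuous functions on $[0,1]$ that are polynomials of degree at most $k$ on each cell of the mesh, and let $u_h\in V_h$ be the finite element solution, i.e. $$\varepsilon^2\int_0^1u_h'v'\,dx+\int_0^1c\,u_hv\,dx=\int_0^1fv\,dx\qquad\text{for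 all }v\in V_h .$$ Then $$\|u-u_h\|_\varepsilon\le C\left(\varepsilon^{1/2}H^k+H^{k+1}\right),\qquad \|v\|_\varepsilon:=\varepsilon|v|_1+|v|_0,$$ where $|v|_0=\|v\|_{L^2(0,1)}$ and $|v|_1=\|v'\|_{L^2(0,1)}$. -/

import Mathlib

open Set

noncomputable section

namespace LayerFEM

/-- `u` is a classical solution, of class `C²` on `[0,1]`, of the Neumann problem
`-ε² u'' + c u = f` in `(0,1)`, `u'(0) = u'(1) = 0`. -/
structure IsNeumannSolution (ε : ℝ) (c f u : ℝ → ℝ) : Prop where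
  contDiffOn : ContDiffOn ℝ 2 u (Icc 0 1)
  eqn : ∀ x ∈ Ioo (0 : ℝ) 1, -ε ^ 2 * deriv (deriv u) x + c x * u x = f x
  left : derivWithin u (Icc 0 1) 0 = 0
  right : derivWithin u (Icc 0 1) 1 = 0

/-- The transition point `τ = ε^((k-1)/k)`. -/
def transition (ε : ℝ) (k : ℕ) : ℝ := ε ^ (((k : ℝ) - 1) / (k : ℝ))

/-- The nodes `x₀ < x₁ < ⋯ < x_{2N+M}` of the mesh of `[0,1]` that is equidistant with `N` cells
in each of the layer regions `[0,τ]` and `[1-τ,1]`, and equidistant with `M` cells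
in `[τ,1-τ]`. -/
def meshNode (τ : ℝ) (N M i : ℕ) : ℝ :=
  if i ≤ N then (i : ℝ) * (τ / N)
  else if i ≤ N + M then τ + ((i : ℝ) - N) * ((1 - 2 * τ) / M)
  else 1 - τ + ((i : ℝ) - N - M) * (τ / N)

/-- The finite element space of order `k` on the mesh: continuous functions on `[0,1]` that
coincide on each cell with a polynomial of degree at most `k`.
(Neumann conditions are natural, so no boundary values are prescribed.) -/
def feSpace (k : ℕ) (τ : ℝ) (N M : ℕ) : Set (ℝ → ℝ) :=
  {v | ContinuousOn v (Icc 0 1) ∧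
    ∀ i < 2 * N + M, ∃ p : Polynomial ℝ, p.natDegree ≤ k ∧
      ∀ x ∈ Icc (meshNode τ N M i) (meshNode τ N M (i + 1)), v x = p.eval x}

/-- The bilinear form `a(v,w) = ε² (v',w') + (c v, w)` of the problem. It is only applied to
continuous, piecewise `C¹` functions, whose weak derivative is the derivative off the nodes. -/
def bilin (ε : ℝ) (c v w : ℝ → ℝ) : ℝ :=
  ε ^ 2 * (∫ x in (0 : ℝ)..1, deriv v x * deriv w x) + ∫ x in (0 : ℝ)..1, c x * v x * w x

/-- `uh` is the finite element solution in the space `V`. -/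
def IsGalerkinSolution (ε : ℝ) (c f : ℝ → ℝ) (V : Set (ℝ → ℝ)) (uh : ℝ → ℝ) : Prop :=
  uh ∈ V ∧ ∀ v ∈ V, bilin ε c uh v = ∫ x in (0 : ℝ)..1, f x * v x

/-- `|v|₀`, the norm of `L²(0,1)`. -/
def normL2 (v : ℝ → ℝ) : ℝ := Real.sqrt (∫ x in (0 : ℝ)..1, v x ^ 2)

/-- `|v|₁`, the seminorm of `H¹(0,1)`, for continuous, piecewise `C¹` functions `v`. -/
def seminormH1 (v : ℝ → ℝ) : ℝ := normL2 (deriv v)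

/-- The energy norm `‖v‖_ε = ε |v|₁ + |v|₀`. -/
def energyNorm (ε : ℝ) (v : ℝ → ℝ) : ℝ := ε * seminormH1 v + normL2 v

end LayerFEM

end

/-! Galerkin orthogonality (`IsGalerkinSolution.error_le`) reduces the claim to the error of one
interpolant, and hence to a bound on the derivative of order `k + 1` that locates where it is large.

That bound is `exists_iteratedDerivWithin_bound`. Write `u = S + w`, with `S` the truncated
expansion `f/c + ε² (f/c)''/c + ⋯` from `exists_smooth_part`: its derivatives are bounded uniformly
in `ε`, and it solves the equation up to `ε^{2k} g`. The remainder `w` then has right-hand side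
`ε^{2k} g` and bounded endpoint slopes. Comparison with a multiple of `ε (e^{-x/ε} + e^{-(1-x)/ε}) +
ε^{2k}` bounds `w`; the leading factor `ε` appears because slopes, not values, are prescribed.
Landau's inequality on windows of length `ε` treats `w'`, and differentiating the equation treats
the rest, each derivative costing `1/ε`. Hence `|u^{(k+1)}| ≤ A (1 + ε^{-k} layer)`.

The transition point is tuned so that `τ^k = ε^{k-1}`. On cells of length at most `α H τ`, the
squared `L²` norm of `ε^{-k} layer`, of order `ε^{1-2k}`, gives a squared `ε`-weighted derivative
error of order `ε² (H τ)^{2k} ε^{1-2k} = ε H^{2k}`. The `L²` error gains a further `H² τ²`, and `τ²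
≤ ε` since `k ≥ 2`. In the middle region `τ/ε = ε^{-1/k}`, so `ε^{-k} layer` is bounded there and
mesh size `H` suffices. -/

namespace LayerFEM

/-! ### Comparison principle under Neumann conditions -/

/-- On the unit interval, a function with strictly negative derivative at `0` has no minimum
there. -/
theorem not_isMinOn_zero {z : ℝ → ℝ} {d : ℝ}
    (hz : HasDerivWithinAt z d (Icc 0 1) 0) (hd : d < 0) : ¬ IsMinOn z (Icc 0 1) 0 := by
  intro h
  have h1 := h.localize.hasFDerivWithinAt_nonneg hz.hasFDerivWithinAt (y := 1)
    (mem_posTangentConeAt_of_segment_subset (by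
      rw [zero_add, segment_eq_Icc zero_le_one]))
  simp at h1
  linarith

/-- On the unit interval, a function with strictly positive derivative at `1` has no minimum
there. -/
theorem not_isMinOn_one {z : ℝ → ℝ} {d : ℝ}
    (hz : HasDerivWithinAt z d (Icc 0 1) 1) (hd : 0 < d) : ¬ IsMinOn z (Icc 0 1) 1 := by
  intro h
  have h1 := h.localize.hasFDerivWithinAt_nonneg hz.hasFDerivWithinAt (y := -1)
    (mem_posTangentConeAt_of_segment_subset (by
      rw [segment_symm, segment_eq_Icc (by norm_num)]; norm_num))
  simp at h1
  linarith

/-- The second derivative is nonnegative at a local minimum. -/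
theorem second_deriv_nonneg_of_isLocalMin {z z1 : ℝ → ℝ} {d x : ℝ}
    (hz : ∀ᶠ y in nhds x, HasDerivAt z (z1 y) y) (hz1 : HasDerivAt z1 d x)
    (hmin : IsLocalMin z x) : 0 ≤ d := by
  by_contra! hd
  have e1 : deriv z =ᶠ[nhds x] z1 := hz.mono fun y hy => hy.deriv
  have h1 : deriv (deriv z) x = d := by rw [e1.deriv_eq, hz1.deriv]
  -- A negative second derivative would make `x` a local maximum as well, hence `z` constant near
  -- `x`, which forces `d = 0`.
  have hmax : IsLocalMax z x := isLocalMax_of_deriv_deriv_neg (h1 ▸ hd) hmin.deriv_eq_zero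
    hz.self_of_nhds.continuousAt
  have hconst : z =ᶠ[nhds x] fun _ => z x := by
    filter_upwards [hmin, hmax] with y h2 h3 using le_antisymm h3 h2
  have h4 : deriv z =ᶠ[nhds x] fun _ => 0 := by
    filter_upwards [hconst.eventuallyEq_nhds] with y hy
    rw [hy.deriv_eq]; simp
  rw [h4.deriv_eq] at h1
  simp at h1
  linarith

/-- Comparison principle for `-ε² z'' + c z ≥ 0` with strict Neumann inequalities. -/
theorem nonneg_of_supersolution {ε : ℝ} {c z z1 z2 : ℝ → ℝ}
    (hz : ∀ x ∈ Icc (0 : ℝ) 1, HasDerivWithinAt z (z1 x) (Icc 0 1) x)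
    (hz1 : ∀ x ∈ Icc (0 : ℝ) 1, HasDerivWithinAt z1 (z2 x) (Icc 0 1) x)
    (hc : ∀ x ∈ Icc (0 : ℝ) 1, 0 < c x)
    (hL : ∀ x ∈ Icc (0 : ℝ) 1, 0 ≤ -ε ^ 2 * z2 x + c x * z x)
    (h0 : z1 0 < 0) (h1 : 0 < z1 1) : ∀ x ∈ Icc (0 : ℝ) 1, 0 ≤ z x := by
  obtain ⟨x, hx, hmin⟩ := isCompact_Icc.exists_isMinOn (nonempty_Icc.2 zero_le_one)
    (fun y hy => (hz y hy).continuousWithinAt)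
  suffices 0 ≤ z x from fun y hy => this.trans (hmin hy)
  by_contra! hneg
  have hx0 : x ≠ 0 := by
    rintro rfl; exact not_isMinOn_zero (hz 0 hx) h0 hmin
  have hx1 : x ≠ 1 := by
    rintro rfl; exact not_isMinOn_one (hz 1 hx) h1 hmin
  have hxo : x ∈ Ioo (0 : ℝ) 1 := ⟨lt_of_le_of_ne hx.1 hx0.symm, lt_of_le_of_ne hx.2 hx1⟩
  have hn : ∀ y ∈ Ioo (0 : ℝ) 1, Icc (0 : ℝ) 1 ∈ nhds y := fun y hy => Icc_mem_nhds hy.1 hy.2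
  have h2 : 0 ≤ z2 x := second_deriv_nonneg_of_isLocalMin
    (by filter_upwards [isOpen_Ioo.mem_nhds hxo] with y hy
        exact (hz y (Ioo_subset_Icc_self hy)).hasDerivAt (hn y hy))
    ((hz1 x hx).hasDerivAt (hn x hxo)) (hmin.isLocalMin (hn x hxo))
  have h3 := hL x hx
  have h4 := mul_neg_of_pos_of_neg (hc x hx) hneg
  nlinarith [mul_nonneg (sq_nonneg ε) h2]

/-! ### Barrier functions for the boundary layers -/

/-- The boundary layer function `e^{-x/ε} + e^{-(1-x)/ε}`. -/
noncomputable def layer (ε x : ℝ) : ℝ := Real.exp (-(x / ε)) + Real.exp (-((1 - x) / ε))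

/-- The weight `ε (e^{-x/ε} + e^{-(1-x)/ε}) + ε^{2n}` bounding the non-smooth part. -/
noncomputable def layerWeight (n : ℕ) (ε x : ℝ) : ℝ := ε * layer ε x + ε ^ (2 * n)

theorem layer_pos (ε x : ℝ) : 0 < layer ε x := by unfold layer; positivity

theorem layerWeight_pos {ε : ℝ} (n : ℕ) (hε : 0 < ε) (x : ℝ) : 0 < layerWeight n ε x := by
  have := layer_pos ε x
  unfold layerWeight; positivity

theorem hasDerivAt_layerWeight {ε : ℝ} (n : ℕ) (hε : 0 < ε) (x : ℝ) :
    HasDerivAt (layerWeight n ε)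
      (-Real.exp (-(x / ε)) + Real.exp (-((1 - x) / ε))) x := by
  have h1 : HasDerivAt (fun x : ℝ => Real.exp (-(x / ε))) (Real.exp (-(x / ε)) * (-(1 / ε))) x :=
    ((hasDerivAt_id x).div_const ε).neg.exp
  have h2 : HasDerivAt (fun x : ℝ => Real.exp (-((1 - x) / ε)))
      (Real.exp (-((1 - x) / ε)) * (-(-1 / ε))) x :=
    (((hasDerivAt_id x).const_sub 1).div_const ε).neg.exp
  have h3 := ((h1.add h2).const_mul ε).add_const (ε ^ (2 * n))
  refine h3.congr_deriv ?_
  field_simp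

theorem hasDerivAt_deriv_layerWeight {ε : ℝ} (x : ℝ) :
    HasDerivAt (fun x : ℝ => -Real.exp (-(x / ε)) + Real.exp (-((1 - x) / ε)))
      (layer ε x / ε) x := by
  have h1 : HasDerivAt (fun x : ℝ => Real.exp (-(x / ε))) (Real.exp (-(x / ε)) * (-(1 / ε))) x :=
    ((hasDerivAt_id x).div_const ε).neg.exp
  have h2 : HasDerivAt (fun x : ℝ => Real.exp (-((1 - x) / ε)))
      (Real.exp (-((1 - x) / ε)) * (-(-1 / ε))) x :=
    (((hasDerivAt_id x).const_sub 1).div_const ε).neg.exp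
  refine (h1.neg.add h2).congr_deriv ?_
  unfold layer; ring

theorem exp_neg_inv_lt_half {ε : ℝ} (hε : 0 < ε) (hε1 : ε < 1) :
    Real.exp (-(1 / ε)) < 1 / 2 := by
  have h1 : (1 : ℝ) < 1 / ε := by rw [lt_div_iff₀ hε]; linarith
  have h2 : (2 : ℝ) < Real.exp (1 / ε) := by
    have := Real.add_one_lt_exp (x := 1 / ε) (by positivity)
    linarith
  rw [Real.exp_neg, inv_lt_comm₀ (by positivity) (by norm_num)]
  simpa using h2

/-- The operator maps the barrier to `A (ε layer (c - 1) + c ε^{2n})`, which dominates the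
right-hand side because `c > 1`. Only an upper bound is proved, so that it can be applied to both
`w` and `-w`. -/
theorem le_layerWeight_of_equation {ε K : ℝ} {n : ℕ} {c w w1 w2 : ℝ → ℝ}
    (hε : 0 < ε) (hε1 : ε < 1) (hK : 0 ≤ K)
    (hw : ∀ x ∈ Icc (0 : ℝ) 1, HasDerivWithinAt w (w1 x) (Icc 0 1) x)
    (hw1 : ∀ x ∈ Icc (0 : ℝ) 1, HasDerivWithinAt w1 (w2 x) (Icc 0 1) x)
    (hc : ∀ x ∈ Icc (0 : ℝ) 1, 1 < c x)
    (hL : ∀ x ∈ Icc (0 : ℝ) 1, -ε ^ 2 * w2 x + c x * w x ≤ K * ε ^ (2 * n))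
    (h0 : |w1 0| ≤ K) (h1 : |w1 1| ≤ K) :
    ∀ x ∈ Icc (0 : ℝ) 1, w x ≤ (2 * K + 1) * layerWeight n ε x := by
  -- At the endpoints the barrier has outward slope `A (1 - e^{-1/ε}) > A / 2`, and `A / 2 > K`
  -- makes the Neumann inequalities strict.
  set A := 2 * K + 1 with hA
  have hhalf := exp_neg_inv_lt_half hε hε1
  have := nonneg_of_supersolution (ε := ε) (c := c)
    (z := fun x => A * layerWeight n ε x - w x)
    (z1 := fun x => A * (-Real.exp (-(x / ε)) + Real.exp (-((1 - x) / ε))) - w1 x)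
    (z2 := fun x => A * (layer ε x / ε) - w2 x)
    (fun x hx => ((hasDerivAt_layerWeight n hε x).hasDerivWithinAt.const_mul A).sub (hw x hx))
    (fun x hx => ((hasDerivAt_deriv_layerWeight x).hasDerivWithinAt.const_mul A).sub (hw1 x hx))
    (fun x hx => zero_lt_one.trans (hc x hx)) ?_ ?_ ?_
  · intro x hx
    have := this x hx
    linarith
  · intro x hx
    have e1 : ε ^ 2 * (A * (layer ε x / ε)) = A * (ε * layer ε x) := by
      field_simp
    have e2 : 0 ≤ A * (ε * layer ε x) * (c x - 1) :=
      mul_nonneg (mul_nonneg (by linarith) (mul_pos hε (layer_pos ε x)).le)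
        (by linarith [hc x hx])
    have e3 : 0 ≤ A * ε ^ (2 * n) * (c x - 1) :=
      mul_nonneg (by positivity) (by linarith [hc x hx])
    have e4 : 0 < ε ^ (2 * n) := by positivity
    have := hL x hx
    unfold layerWeight
    nlinarith
  · have := abs_le.1 h0
    simp only [zero_div, neg_zero, Real.exp_zero, sub_zero]
    nlinarith
  · have := abs_le.1 h1
    simp only [sub_self, zero_div, neg_zero, Real.exp_zero]
    nlinarith

/-- The barrier estimate for the remainder of the asymptotic expansion. -/
theorem abs_le_layerWeight_of_equation {ε K : ℝ} {n : ℕ} {c w w1 w2 : ℝ → ℝ}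
    (hε : 0 < ε) (hε1 : ε < 1) (hK : 0 ≤ K)
    (hw : ∀ x ∈ Icc (0 : ℝ) 1, HasDerivWithinAt w (w1 x) (Icc 0 1) x)
    (hw1 : ∀ x ∈ Icc (0 : ℝ) 1, HasDerivWithinAt w1 (w2 x) (Icc 0 1) x)
    (hc : ∀ x ∈ Icc (0 : ℝ) 1, 1 < c x)
    (hL : ∀ x ∈ Icc (0 : ℝ) 1, |-ε ^ 2 * w2 x + c x * w x| ≤ K * ε ^ (2 * n))
    (h0 : |w1 0| ≤ K) (h1 : |w1 1| ≤ K) :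
    ∀ x ∈ Icc (0 : ℝ) 1, |w x| ≤ (2 * K + 1) * layerWeight n ε x := by
  intro x hx
  have h2 := le_layerWeight_of_equation hε hε1 hK hw hw1 hc
    (fun x hx => (abs_le.1 (hL x hx)).2) h0 h1 x hx
  have h3 := le_layerWeight_of_equation (w := fun x => -w x) (w1 := fun x => -w1 x)
    (w2 := fun x => -w2 x) (n := n) hε hε1 hK
    (fun x hx => (hw x hx).neg) (fun x hx => (hw1 x hx).neg) hc
    (fun x hx => by have := (abs_le.1 (hL x hx)).1; linarith) (by simpa using h0)
    (by simpa using h1) x hx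
  exact abs_le.2 ⟨by linarith, h2⟩

/-! ### First derivative of the remainder -/

/-- Landau's inequality: the first derivative is controlled by the function and its second
derivative. -/
theorem abs_deriv_le_of_second_deriv {a b P Q : ℝ} {w w1 w2 : ℝ → ℝ} (hab : a < b)
    (hw : ∀ x ∈ Icc a b, HasDerivWithinAt w (w1 x) (Icc a b) x)
    (hw1 : ∀ x ∈ Icc a b, HasDerivWithinAt w1 (w2 x) (Icc a b) x)
    (hP : ∀ x ∈ Icc a b, |w x| ≤ P) (hQ : ∀ x ∈ Icc a b, |w2 x| ≤ Q) :
    ∀ x ∈ Icc a b, |w1 x| ≤ 2 * P / (b - a) + Q * (b - a) := by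
  intro x hx
  -- The mean value theorem bounds the derivative at one point; the second derivative carries this
  -- to every point.
  obtain ⟨y, hy, hslope⟩ := exists_hasDerivAt_eq_slope w w1 hab
    (fun x hx => (hw x hx).continuousWithinAt)
    (fun x hx => (hw x (Ioo_subset_Icc_self hx)).hasDerivAt (Icc_mem_nhds hx.1 hx.2))
  have hy' := Ioo_subset_Icc_self hy
  have h1 := (convex_Icc a b).norm_image_sub_le_of_norm_hasDerivWithin_le hw1 hQ hy' hx
  have hQ0 : 0 ≤ Q := (abs_nonneg _).trans (hQ x hx)
  have h2 : |x - y| ≤ b - a := abs_sub_le_of_le_of_le hx.1 hx.2 hy'.1 hy'.2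
  have h3 : |w1 y| ≤ 2 * P / (b - a) := by
    rw [hslope, abs_div, abs_of_pos (sub_pos.2 hab)]
    have := abs_sub (w b) (w a)
    have := hP a (left_mem_Icc.2 hab.le)
    have := hP b (right_mem_Icc.2 hab.le)
    gcongr
    · linarith
  have h4 : |w1 x - w1 y| ≤ Q * (b - a) := h1.trans (by
    rw [Real.norm_eq_abs]; gcongr)
  have h5 : |w1 x| ≤ |w1 x - w1 y| + |w1 y| := by
    simpa using abs_add_le (w1 x - w1 y) (w1 y)
  linarith

/-- Each exponent has Lipschitz constant `1 / ε`, so a shift by at most `ε` costs at most a factor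
`e`. -/
theorem layer_le_of_abs_sub_le {ε x y : ℝ} (hε : 0 < ε) (hxy : |x - y| ≤ ε) :
    layer ε y ≤ Real.exp 1 * layer ε x := by
  obtain ⟨h1, h2⟩ := abs_le.1 hxy
  unfold layer
  rw [mul_add, ← Real.exp_add, ← Real.exp_add]
  have e1 : (x - y) / ε ≤ 1 := by rw [div_le_one hε]; exact h2
  have e2 : (y - x) / ε ≤ 1 := by rw [div_le_one hε]; linarith
  gcongr
  · rw [sub_div] at e1; linarith
  · rw [sub_div] at e2 ⊢; rw [sub_div]; linarith

theorem layerWeight_le_of_abs_sub_le {ε x y : ℝ} (n : ℕ) (hε : 0 < ε) (hxy : |x - y| ≤ ε) :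
    layerWeight n ε y ≤ Real.exp 1 * layerWeight n ε x := by
  have h1 := layer_le_of_abs_sub_le hε hxy
  have h2 : (1 : ℝ) ≤ Real.exp 1 := Real.one_le_exp zero_le_one
  have h3 : 0 < ε ^ (2 * n) := by positivity
  unfold layerWeight
  nlinarith [mul_le_mul_of_nonneg_left h1 hε.le]

/-- Bound of the first derivative by the layer weight. -/
theorem abs_deriv_le_layerWeight {ε K : ℝ} {n : ℕ} {w w1 w2 : ℝ → ℝ}
    (hε : 0 < ε) (hε1 : ε < 1) (hK : 0 ≤ K)
    (hw : ∀ x ∈ Icc (0 : ℝ) 1, HasDerivWithinAt w (w1 x) (Icc 0 1) x)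
    (hw1 : ∀ x ∈ Icc (0 : ℝ) 1, HasDerivWithinAt w1 (w2 x) (Icc 0 1) x)
    (h0 : ∀ x ∈ Icc (0 : ℝ) 1, |w x| ≤ K * layerWeight n ε x)
    (h2 : ∀ x ∈ Icc (0 : ℝ) 1, |w2 x| ≤ K * layerWeight n ε x / ε ^ 2) :
    ∀ x ∈ Icc (0 : ℝ) 1, |w1 x| ≤ 3 * Real.exp 1 * K * layerWeight n ε x / ε := by
  intro x hx
  -- Left end of a window of length `ε` that contains `x` and stays in `[0,1]`. With this length
  -- both terms of Landau's inequality are of order `1 / ε`, namely `2` and `1` times the same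
  -- quantity.
  set a := min x (1 - ε) with ha
  have ha0 : 0 ≤ a := le_min hx.1 (by linarith)
  have hax : a ≤ x := min_le_left _ _
  have ha1 : a ≤ 1 - ε := min_le_right _ _
  have hxa : x ≤ a + ε := by
    rcases min_choice x (1 - ε) with h | h <;> rw [ha, h] <;> linarith [hx.2]
  have hsub : Icc a (a + ε) ⊆ Icc (0 : ℝ) 1 := Icc_subset_Icc ha0 (by linarith)
  have hΛ : ∀ y ∈ Icc a (a + ε), layerWeight n ε y ≤ Real.exp 1 * layerWeight n ε x :=
    fun y hy => layerWeight_le_of_abs_sub_le n hε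
      (abs_le.2 ⟨by linarith [hy.2], by linarith [hy.1]⟩)
  have h3 := abs_deriv_le_of_second_deriv (a := a) (b := a + ε)
    (P := K * (Real.exp 1 * layerWeight n ε x))
    (Q := K * (Real.exp 1 * layerWeight n ε x) / ε ^ 2) (by linarith)
    (fun y hy => (hw y (hsub hy)).mono hsub) (fun y hy => (hw1 y (hsub hy)).mono hsub)
    (fun y hy => (h0 y (hsub hy)).trans (by gcongr; exact hΛ y hy))
    (fun y hy => (h2 y (hsub hy)).trans (by gcongr; exact hΛ y hy)) x ⟨hax, hxa⟩
  refine h3.trans (le_of_eq ?_)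
  rw [add_sub_cancel_left]
  field_simp
  ring

/-! ### Asymptotic expansion and higher derivatives of the remainder -/

theorem hasDerivWithinAt_iteratedDerivWithin {s : Set ℝ} {w : ℝ → ℝ} {n j : ℕ} {x : ℝ}
    (hs : UniqueDiffOn ℝ s) (hw : ContDiffOn ℝ n w s) (hj : j < n) (hx : x ∈ s) :
    HasDerivWithinAt (iteratedDerivWithin j w s) (iteratedDerivWithin (j + 1) w s x) s x := by
  rw [iteratedDerivWithin_succ]
  exact (hw.differentiableOn_iteratedDerivWithin (by exact_mod_cast hj) hs x hx).hasDerivWithinAt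

theorem iteratedDerivWithin_add_two {s : Set ℝ} (w : ℝ → ℝ) (j : ℕ) :
    iteratedDerivWithin (j + 2) w s = iteratedDerivWithin j (iteratedDerivWithin 2 w s) s := by
  simp [iteratedDerivWithin_succ']

theorem contDiffOn_iteratedDerivWithin_two {s : Set ℝ} {w : ℝ → ℝ} {n : ℕ}
    (hs : UniqueDiffOn ℝ s) (hw : ContDiffOn ℝ (n + 2 : ℕ) w s) :
    ContDiffOn ℝ n (iteratedDerivWithin 2 w s) s := by
  have h1 : ContDiffOn ℝ (n + 1 : ℕ) (derivWithin w s) s :=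
    hw.derivWithin hs (by norm_cast)
  have h2 : ContDiffOn ℝ n (derivWithin (derivWithin w s) s) s :=
    h1.derivWithin hs (by norm_cast)
  simpa [iteratedDerivWithin_succ'] using h2

theorem exists_bound_iteratedDerivWithin {p : ℕ} {g : ℝ → ℝ}
    (hg : ContDiffOn ℝ p g (Icc 0 1)) :
    ∃ K, 0 ≤ K ∧ ∀ j ≤ p, ∀ x ∈ Icc (0 : ℝ) 1, |iteratedDerivWithin j g (Icc 0 1) x| ≤ K := by
  have h : ∀ j, ∃ B : ℝ, 0 ≤ B ∧ (j ≤ p → ∀ x ∈ Icc (0 : ℝ) 1,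
      |iteratedDerivWithin j g (Icc 0 1) x| ≤ B) := by
    intro j
    by_cases hj : j ≤ p
    · obtain ⟨B, hB⟩ := isCompact_Icc.exists_bound_of_continuousOn
        (hg.continuousOn_iteratedDerivWithin (by exact_mod_cast hj) uniqueDiffOn_Icc_zero_one)
      exact ⟨|B|, abs_nonneg _, fun _ x hx => (hB x hx).trans (le_abs_self _)⟩
    · exact ⟨0, le_rfl, fun h => absurd h hj⟩
  choose B hB0 hB using h
  refine ⟨∑ j ∈ Finset.range (p + 1), B j, Finset.sum_nonneg fun j _ => hB0 j,
    fun j hj x hx => (hB j hj x hx).trans ?_⟩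
  exact Finset.single_le_sum (fun j _ => hB0 j) (Finset.mem_range.2 (by omega))

/-- The smooth part of the asymptotic expansion of the solution: for every order `n` there is a
function with derivatives bounded uniformly in `ε` that solves the equation up to `ε^{2n} g`. -/
theorem exists_smooth_part {p : ℕ} (hp : 2 ≤ p) (n : ℕ) {c : ℝ → ℝ}
    (hc : ContDiffOn ℝ (p + 2 * n : ℕ) c (Icc 0 1)) (hc1 : ∀ x ∈ Icc (0 : ℝ) 1, 1 < c x)
    {f : ℝ → ℝ} (hf : ContDiffOn ℝ (p + 2 * n : ℕ) f (Icc 0 1)) :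
    ∃ (g : ℝ → ℝ) (K : ℝ), 0 ≤ K ∧ ContDiffOn ℝ p g (Icc 0 1) ∧ ∀ ε : ℝ, 0 < ε → ε < 1 →
      ∃ S : ℝ → ℝ, ContDiffOn ℝ p S (Icc 0 1) ∧
        (∀ j ≤ p, ∀ x ∈ Icc (0 : ℝ) 1, |iteratedDerivWithin j S (Icc 0 1) x| ≤ K) ∧
        ∀ x ∈ Icc (0 : ℝ) 1, -ε ^ 2 * iteratedDerivWithin 2 S (Icc 0 1) x + c x * S x
          = f x - ε ^ (2 * n) * g x := by
  induction n generalizing f with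
  | zero =>
    refine ⟨f, 0, le_rfl, by simpa using hf, fun ε _ _ => ⟨fun _ => 0, contDiffOn_const, ?_, ?_⟩⟩
    · intro j _ x _
      simp
    · intro x _
      simp
  | succ n ih =>
    have hF : ContDiffOn ℝ (p + 2 * n + 2 : ℕ) (fun x => f x / c x) (Icc 0 1) :=
      hf.div hc fun x hx => (zero_lt_one.trans (hc1 x hx)).ne'
    have hFp : ContDiffOn ℝ p (fun x => f x / c x) (Icc 0 1) :=
      hF.of_le (by norm_cast; omega)
    -- `f / c` solves the equation up to `-ε² (f/c)''`, so `ε²` times an approximate solution with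
    -- data `(f/c)''` is added. The data change at each step and lose two derivatives.
    obtain ⟨g, K, hK, hg, hS⟩ := ih (hc.of_le (by norm_cast; omega))
      (contDiffOn_iteratedDerivWithin_two uniqueDiffOn_Icc_zero_one hF)
    obtain ⟨K', hK', hb⟩ := exists_bound_iteratedDerivWithin hFp
    refine ⟨g, K' + K, by positivity, hg, fun ε hε hε1 => ?_⟩
    obtain ⟨S, hSp, hSb, hSe⟩ := hS ε hε hε1
    have hSc : ContDiffOn ℝ p (ε ^ 2 • S) (Icc 0 1) := hSp.const_smul (ε ^ 2)
    have hadd : ∀ j ≤ p, ∀ x ∈ Icc (0 : ℝ) 1,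
        iteratedDerivWithin j ((fun x => f x / c x) + ε ^ 2 • S) (Icc 0 1) x =
        iteratedDerivWithin j (fun x => f x / c x) (Icc 0 1) x
          + ε ^ 2 * iteratedDerivWithin j S (Icc 0 1) x := by
      intro j hj x hx
      have hj' : (j : WithTop ℕ∞) ≤ p := by exact_mod_cast hj
      rw [iteratedDerivWithin_add hx uniqueDiffOn_Icc_zero_one ((hFp x hx).of_le hj')
        ((hSc x hx).of_le hj'), iteratedDerivWithin_const_smul hx
        uniqueDiffOn_Icc_zero_one _ ((hSp x hx).of_le hj'), smul_eq_mul]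
    refine ⟨(fun x => f x / c x) + ε ^ 2 • S, hFp.add hSc, ?_, ?_⟩
    · intro j hj x hx
      rw [hadd j hj x hx]
      refine (abs_add_le _ _).trans (add_le_add (hb j hj x hx) ?_)
      rw [abs_mul, abs_of_pos (by positivity)]
      have := hSb j hj x hx
      have h2 : ε ^ 2 ≤ 1 := pow_le_one₀ hε.le hε1.le
      exact (mul_le_of_le_one_left (abs_nonneg _) h2).trans this
    · intro x hx
      rw [hadd 2 hp x hx]
      have h1 := hSe x hx
      have h2 : c x ≠ 0 := (zero_lt_one.trans (hc1 x hx)).ne'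
      simp only [Pi.add_apply, Pi.smul_apply, smul_eq_mul]
      have h3 : c x * (f x / c x) = f x := by field_simp
      linear_combination ε ^ 2 * h1 + h3

/-- Bounds of all derivatives of the remainder of the asymptotic expansion. -/
theorem exists_deriv_bound_of_equation {p n : ℕ} {K K' : ℝ} {c g : ℝ → ℝ}
    (hK : 0 ≤ K) (hK' : 0 ≤ K')
    (hc : ContDiffOn ℝ p c (Icc 0 1)) (hg : ContDiffOn ℝ p g (Icc 0 1))
    (hcb : ∀ j ≤ p, ∀ x ∈ Icc (0 : ℝ) 1, |iteratedDerivWithin j c (Icc 0 1) x| ≤ K)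
    (hgb : ∀ j ≤ p, ∀ x ∈ Icc (0 : ℝ) 1, |iteratedDerivWithin j g (Icc 0 1) x| ≤ K) :
    ∀ j ≤ p, ∃ A, 0 ≤ A ∧ ∀ ε : ℝ, 0 < ε → ε < 1 → ∀ w : ℝ → ℝ, ContDiffOn ℝ p w (Icc 0 1) →
      (∀ x ∈ Icc (0 : ℝ) 1, |w x| ≤ K' * layerWeight n ε x) →
      (∀ x ∈ Icc (0 : ℝ) 1,
        |iteratedDerivWithin 1 w (Icc 0 1) x| ≤ K' * layerWeight n ε x / ε) →
      (∀ x ∈ Icc (0 : ℝ) 1, -ε ^ 2 * iteratedDerivWithin 2 w (Icc 0 1) x + c x * w x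
        = ε ^ (2 * n) * g x) →
      ∀ x ∈ Icc (0 : ℝ) 1,
        |iteratedDerivWithin j w (Icc 0 1) x| ≤ A * (layerWeight n ε x / ε ^ j) := by
  intro j
  induction j using Nat.strong_induction_on with
  | _ j ih =>
  match j, ih with
  | 0, _ =>
    exact fun _ => ⟨K', hK', fun ε _ _ w _ h0 _ _ x hx => by simpa using h0 x hx⟩
  | 1, _ =>
    exact fun _ => ⟨K', hK', fun ε _ _ w _ _ h1 _ x hx => by
      simpa [mul_div_assoc] using h1 x hx⟩
  | j + 2, ih =>
    intro hj
    choose! A hA0 hA using fun i (hi : i < j + 2) => ih i hi (by omega)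
    -- Leibniz' rule for `w'' = ε⁻² (c w - ε^{2n} g)`: the sum comes from `c w`. The last `K` comes
    -- from `g`, whose factor `ε^{2n}` is a summand of the weight.
    refine ⟨∑ i ∈ Finset.range (j + 1), (j.choose i : ℝ) * (K * A (j - i)) + K, ?_, ?_⟩
    · refine add_nonneg (Finset.sum_nonneg fun i hi => ?_) hK
      have := hA0 (j - i) (by omega)
      positivity
    intro ε hε hε1 w hw h0 h1 heq x hx
    have hjp : (j : WithTop ℕ∞) ≤ p := by norm_cast; omega
    have hE : EqOn (iteratedDerivWithin 2 w (Icc 0 1))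
        ((1 / ε ^ 2) • (c * w - ε ^ (2 * n) • g)) (Icc 0 1) := by
      intro y hy
      have := heq y hy
      simp only [Pi.smul_apply, Pi.sub_apply, Pi.mul_apply, smul_eq_mul]
      field_simp
      linarith
    have hc' := (hc x hx).of_le hjp
    have hg' := (hg x hx).of_le hjp
    have hw' := (hw x hx).of_le hjp
    have hu := uniqueDiffOn_Icc_zero_one
    have hcw : ContDiffWithinAt ℝ j (c * w) (Icc 0 1) x := hc'.mul hw'
    have hgs : ContDiffWithinAt ℝ j (ε ^ (2 * n) • g) (Icc 0 1) x := hg'.const_smul (ε ^ (2 * n))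
    have hcg : ContDiffWithinAt ℝ j (c * w - ε ^ (2 * n) • g) (Icc 0 1) x := hcw.sub hgs
    rw [iteratedDerivWithin_add_two, iteratedDerivWithin_congr hE hx,
      iteratedDerivWithin_const_smul hx hu _ hcg,
      iteratedDerivWithin_sub hx hu hcw hgs,
      iteratedDerivWithin_const_smul hx hu _ hg', iteratedDerivWithin_mul hx hu hc' hw',
      smul_eq_mul, smul_eq_mul, abs_mul, abs_of_pos (by positivity)]
    set Λ := layerWeight n ε x with hΛ
    have hΛ0 : 0 < Λ := layerWeight_pos n hε x
    have b1 : |∑ i ∈ Finset.range (j + 1), (j.choose i : ℝ) *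
        iteratedDerivWithin i c (Icc 0 1) x * iteratedDerivWithin (j - i) w (Icc 0 1) x| ≤
        (∑ i ∈ Finset.range (j + 1), (j.choose i : ℝ) * (K * A (j - i))) * (Λ / ε ^ j) := by
      refine (Finset.abs_sum_le_sum_abs _ _).trans ?_
      rw [Finset.sum_mul]
      refine Finset.sum_le_sum fun i hi => ?_
      have hi' : i ≤ j := by simpa [Nat.lt_succ_iff] using hi
      rw [abs_mul, abs_mul, Nat.abs_cast, mul_assoc, mul_assoc]
      have e1 := hcb i (by omega) x hx
      have e2 := hA (j - i) (by omega) ε hε hε1 w hw h0 h1 heq x hx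
      have e3 : A (j - i) * (Λ / ε ^ (j - i)) ≤ A (j - i) * (Λ / ε ^ j) := by
        have := hA0 (j - i) (by omega)
        have := pow_le_pow_of_le_one hε.le hε1.le (Nat.sub_le j i)
        gcongr
      have e4 : |iteratedDerivWithin i c (Icc 0 1) x| *
          |iteratedDerivWithin (j - i) w (Icc 0 1) x| ≤ K * (A (j - i) * (Λ / ε ^ j)) :=
        mul_le_mul e1 (e2.trans e3) (abs_nonneg _) hK
      calc _ ≤ (j.choose i : ℝ) * (K * (A (j - i) * (Λ / ε ^ j))) := by gcongr
        _ = _ := by ring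
    have b2 : |ε ^ (2 * n) * iteratedDerivWithin j g (Icc 0 1) x| ≤ K * (Λ / ε ^ j) := by
      rw [abs_mul, abs_of_pos (by positivity), mul_comm]
      have e1 := hgb j (by omega) x hx
      have e2 : ε ^ (2 * n) ≤ Λ := by
        have := layer_pos ε x
        rw [hΛ, layerWeight]
        have : 0 < ε * layer ε x := by positivity
        linarith
      have e3 : Λ ≤ Λ / ε ^ j :=
        le_div_self hΛ0.le (by positivity) (pow_le_one₀ hε.le hε1.le)
      exact mul_le_mul e1 (e2.trans e3) (by positivity) hK
    have b3 := (abs_sub _ _).trans (add_le_add b1 b2)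
    calc _ ≤ 1 / ε ^ 2 * _ := mul_le_mul_of_nonneg_left b3 (by positivity)
      _ = _ := by
        generalize ∑ i ∈ Finset.range (j + 1), (j.choose i : ℝ) * (K * A (j - i)) = T
        rw [pow_add]
        field_simp

/-! ### Regularity and a priori bounds for the solution -/

/-- Bootstrapping: the equation expresses `u''` through `c`, `u` and `f`, so each round raises the
regularity of `u`. -/
theorem contDiffOn_of_second_deriv {p : ℕ} {u c f : ℝ → ℝ} {ε : ℝ}
    (hc : ContDiffOn ℝ p c (Icc 0 1)) (hf : ContDiffOn ℝ p f (Icc 0 1))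
    (hu : ContDiffOn ℝ 2 u (Icc 0 1))
    (heq : ∀ x ∈ Icc (0 : ℝ) 1,
      derivWithin (derivWithin u (Icc 0 1)) (Icc 0 1) x = (c x * u x - f x) / ε ^ 2) :
    ∀ q ≤ p, ContDiffOn ℝ (q + 2 : ℕ) u (Icc 0 1) := by
  intro q
  have hs := uniqueDiffOn_Icc_zero_one
  induction q with
  | zero => intro _; exact_mod_cast hu
  | succ q ih =>
    intro hq
    have h1 : ContDiffOn ℝ (q + 1 : ℕ) u (Icc 0 1) :=
      (ih (by omega)).of_le (by norm_cast; omega)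
    have hq' : ((q + 1 : ℕ) : WithTop ℕ∞) ≤ p := by exact_mod_cast hq
    have h2 : ContDiffOn ℝ (q + 1 : ℕ) (derivWithin (derivWithin u (Icc 0 1)) (Icc 0 1))
        (Icc 0 1) :=
      ((((hc.of_le hq').mul h1).sub (hf.of_le hq')).div_const (ε ^ 2)).congr heq
    have h3 : ContDiffOn ℝ 1 (derivWithin u (Icc 0 1)) (Icc 0 1) :=
      hu.derivWithin hs (by norm_num)
    have h4 : ContDiffOn ℝ ((q + 1 : ℕ) + 1) (derivWithin u (Icc 0 1)) (Icc 0 1) :=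
      (contDiffOn_succ_iff_derivWithin hs).2
        ⟨h3.differentiableOn one_ne_zero, by simp, h2⟩
    have h5 : ContDiffOn ℝ (((q + 1 : ℕ) + 1 : WithTop ℕ∞) + 1) u (Icc 0 1) :=
      (contDiffOn_succ_iff_derivWithin hs).2
        ⟨hu.differentiableOn two_ne_zero, by intro h; exact absurd h (by norm_cast), h4⟩
    exact_mod_cast h5

/-- The equation is given on the open interval only; both sides are continuous on `[0,1]`, so
density extends it to the endpoints. -/
theorem IsNeumannSolution.iteratedDerivWithin_two {ε : ℝ} {c f u : ℝ → ℝ}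
    (hε : 0 < ε) (hu : IsNeumannSolution ε c f u)
    (hc : ContinuousOn c (Icc 0 1)) (hf : ContinuousOn f (Icc 0 1)) :
    ∀ x ∈ Icc (0 : ℝ) 1,
      iteratedDerivWithin 2 u (Icc 0 1) x = (c x * u x - f x) / ε ^ 2 := by
  have hs := uniqueDiffOn_Icc_zero_one
  have hcont : ContinuousOn (iteratedDerivWithin 2 u (Icc 0 1)) (Icc 0 1) :=
    hu.contDiffOn.continuousOn_iteratedDerivWithin le_rfl hs
  have hE : EqOn (iteratedDerivWithin 2 u (Icc 0 1))
      (fun x => (c x * u x - f x) / ε ^ 2) (Ioo 0 1) := by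
    intro x hx
    have h1 : derivWithin u (Icc 0 1) =ᶠ[nhds x] deriv u := by
      filter_upwards [isOpen_Ioo.mem_nhds hx] with y hy
      exact derivWithin_of_mem_nhds (Icc_mem_nhds hy.1 hy.2)
    have h2 : iteratedDerivWithin 2 u (Icc 0 1) x = deriv (deriv u) x := by
      simp only [iteratedDerivWithin_succ', iteratedDerivWithin_zero]
      rw [derivWithin_of_mem_nhds (Icc_mem_nhds hx.1 hx.2), h1.deriv_eq]
    have h3 := hu.eqn x hx
    simp only [h2]
    field_simp
    linarith
  exact hE.of_subset_closure hcont (((hc.mul hu.contDiffOn.continuousOn).sub hf).div_const _)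
    Ioo_subset_Icc_self (by rw [closure_Ioo zero_ne_one])

/-- A priori bound of the highest derivative of the solution entering the interpolation error. -/
theorem exists_iteratedDerivWithin_bound {k : ℕ} (hk : 1 ≤ k) {c f : ℝ → ℝ}
    (hc : ContDiffOn ℝ (k + 1 + 2 * k : ℕ) c (Icc 0 1))
    (hf : ContDiffOn ℝ (k + 1 + 2 * k : ℕ) f (Icc 0 1))
    (hc1 : ∀ x ∈ Icc (0 : ℝ) 1, 1 < c x) :
    ∃ A, 0 ≤ A ∧ ∀ ε : ℝ, 0 < ε → ε < 1 → ∀ u, IsNeumannSolution ε c f u →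
      ContDiffOn ℝ (k + 1 : ℕ) u (Icc 0 1) ∧ ∀ x ∈ Icc (0 : ℝ) 1,
        |iteratedDerivWithin (k + 1) u (Icc 0 1) x| ≤ A * (1 + layer ε x / ε ^ k) := by
  have hs := uniqueDiffOn_Icc_zero_one
  have hle : ((k + 1 : ℕ) : WithTop ℕ∞) ≤ (k + 1 + 2 * k : ℕ) := by norm_cast; omega
  have hcp := hc.of_le hle
  have hfp := hf.of_le hle
  obtain ⟨g, K₁, hK₁, hg, hS⟩ := exists_smooth_part (by omega) k hc hc1 hf
  obtain ⟨K₂, hK₂, hcb⟩ := exists_bound_iteratedDerivWithin hcp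
  obtain ⟨K₃, hK₃, hgb⟩ := exists_bound_iteratedDerivWithin hg
  set K := K₁ + K₂ + K₃ with hKdef
  have hK : 0 ≤ K := by positivity
  replace hcb : ∀ j ≤ k + 1, ∀ x ∈ Icc (0 : ℝ) 1, |iteratedDerivWithin j c (Icc 0 1) x| ≤ K :=
    fun j hj x hx => (hcb j hj x hx).trans (by linarith)
  replace hgb : ∀ j ≤ k + 1, ∀ x ∈ Icc (0 : ℝ) 1, |iteratedDerivWithin j g (Icc 0 1) x| ≤ K :=
    fun j hj x hx => (hgb j hj x hx).trans (by linarith)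
  -- From `|c w| + ε^{2k} |g| ≤ (K (2K + 1) + K) Λ ≤ P Λ`, with `Λ` the layer weight; this bounds
  -- `ε² w''`. `P'` below serves for `w` and `ε w'` together.
  set P := (K + 1) * (2 * K + 1) with hP
  have hP0 : 0 ≤ P := by positivity
  set P' := P + 3 * Real.exp 1 * P with hP'
  have hexp := Real.exp_pos 1
  obtain ⟨A, hA0, hA⟩ := exists_deriv_bound_of_equation (n := k) (K' := P') hK (by positivity)
    hcp hg hcb hgb (k + 1) le_rfl
  refine ⟨A + K, by positivity, fun ε hε hε1 u hu => ?_⟩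
  have hu2 := hu.iteratedDerivWithin_two hε hc.continuousOn hf.continuousOn
  have hup : ContDiffOn ℝ (k + 1 : ℕ) u (Icc 0 1) :=
    (contDiffOn_of_second_deriv hcp hfp hu.contDiffOn
      (by simpa [iteratedDerivWithin_succ'] using hu2) (k + 1) le_rfl).of_le
      (by norm_cast; omega)
  refine ⟨hup, ?_⟩
  obtain ⟨S, hSp, hSb, hSe⟩ := hS ε hε hε1
  replace hSb : ∀ j ≤ k + 1, ∀ x ∈ Icc (0 : ℝ) 1, |iteratedDerivWithin j S (Icc 0 1) x| ≤ K :=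
    fun j hj x hx => (hSb j hj x hx).trans (by linarith)
  have hsub : ∀ j ≤ k + 1, ∀ x ∈ Icc (0 : ℝ) 1,
      iteratedDerivWithin j (u - S) (Icc 0 1) x =
        iteratedDerivWithin j u (Icc 0 1) x - iteratedDerivWithin j S (Icc 0 1) x := by
    intro j hj x hx
    have hj' : (j : WithTop ℕ∞) ≤ (k + 1 : ℕ) := by exact_mod_cast hj
    exact iteratedDerivWithin_sub hx hs ((hup x hx).of_le hj') ((hSp x hx).of_le hj')
  have hw := hup.sub hSp
  change ContDiffOn ℝ (k + 1 : ℕ) (u - S) (Icc 0 1) at hw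
  set w := u - S with hwdef
  have heq : ∀ x ∈ Icc (0 : ℝ) 1, -ε ^ 2 * iteratedDerivWithin 2 w (Icc 0 1) x + c x * w x
        = ε ^ (2 * k) * g x := by
    intro x hx
    have h1 := hu2 x hx
    have h2 := hSe x hx
    have h3 : ε ^ 2 * iteratedDerivWithin 2 u (Icc 0 1) x = c x * u x - f x := by
      rw [h1]; field_simp
    rw [hsub 2 (by omega) x hx, hwdef, Pi.sub_apply]
    linear_combination -h3 - h2
  have hd0 : ∀ x ∈ Icc (0 : ℝ) 1,
      HasDerivWithinAt w (iteratedDerivWithin 1 w (Icc 0 1) x) (Icc 0 1) x := by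
    intro x hx
    simpa using hasDerivWithinAt_iteratedDerivWithin (j := 0) hs hw (by omega) hx
  have hd1 : ∀ x ∈ Icc (0 : ℝ) 1, HasDerivWithinAt (iteratedDerivWithin 1 w (Icc 0 1))
      (iteratedDerivWithin 2 w (Icc 0 1) x) (Icc 0 1) x :=
    fun x hx => hasDerivWithinAt_iteratedDerivWithin (j := 1) hs hw (by omega) hx
  have hg0 : ∀ x ∈ Icc (0 : ℝ) 1, |g x| ≤ K := by simpa using hgb 0 (by omega)
  have hc0 : ∀ x ∈ Icc (0 : ℝ) 1, |c x| ≤ K := by simpa using hcb 0 (by omega)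
  -- Since `u' = 0` at the endpoints, the slope of `w` there is `-S'`.
  have hbd : ∀ x ∈ Icc (0 : ℝ) 1, derivWithin u (Icc 0 1) x = 0 →
      |iteratedDerivWithin 1 w (Icc 0 1) x| ≤ K := by
    intro x hx h
    have := hSb 1 (by omega) x hx
    rw [hsub 1 (by omega) x hx, iteratedDerivWithin_one, h, zero_sub, abs_neg]
    exact this
  have hw0 : ∀ x ∈ Icc (0 : ℝ) 1, |w x| ≤ (2 * K + 1) * layerWeight k ε x :=
    abs_le_layerWeight_of_equation hε hε1 hK hd0 hd1 hc1
      (fun x hx => by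
        rw [heq x hx, abs_mul, abs_of_pos (by positivity), mul_comm]
        have := hg0 x hx
        gcongr)
      (hbd 0 (by simp) hu.left) (hbd 1 (by simp) hu.right)
  have hΛ : ∀ x, 0 < layerWeight k ε x := layerWeight_pos k hε
  have hεΛ : ∀ x, ε ^ (2 * k) ≤ layerWeight k ε x := by
    intro x
    have := mul_pos hε (layer_pos ε x)
    rw [layerWeight]; linarith
  have hw2 : ∀ x ∈ Icc (0 : ℝ) 1,
      |iteratedDerivWithin 2 w (Icc 0 1) x| ≤ P * layerWeight k ε x / ε ^ 2 := by
    intro x hx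
    have e1 : iteratedDerivWithin 2 w (Icc 0 1) x = (c x * w x - ε ^ (2 * k) * g x) / ε ^ 2 := by
      have := heq x hx
      field_simp
      linarith
    rw [e1, abs_div, abs_of_pos (a := ε ^ 2) (by positivity)]
    gcongr
    refine (abs_sub _ _).trans ?_
    rw [abs_mul, abs_mul, abs_of_pos (a := ε ^ (2 * k)) (by positivity)]
    have e2 := mul_le_mul (hc0 x hx) (hw0 x hx) (abs_nonneg _) hK
    have e3 := mul_le_mul (hεΛ x) (hg0 x hx) (abs_nonneg _) (hΛ x).le
    have e4 : 0 ≤ (K + 1) * layerWeight k ε x := by have := hΛ x; positivity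
    rw [hP]
    linarith
  have hw0' : ∀ x ∈ Icc (0 : ℝ) 1, |w x| ≤ P * layerWeight k ε x := by
    intro x hx
    refine (hw0 x hx).trans ?_
    have := hΛ x
    gcongr
    rw [hP]
    nlinarith
  have hw1 := abs_deriv_le_layerWeight hε hε1 hP0 hd0 hd1 hw0' hw2
  intro x hx
  have hx2 : |iteratedDerivWithin (k + 1) w (Icc 0 1) x| ≤
      A * (layerWeight k ε x / ε ^ (k + 1)) := by
    refine hA ε hε hε1 w hw (fun y hy => (hw0' y hy).trans ?_) (fun y hy => (hw1 y hy).trans ?_)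
      heq x hx
    · have := hΛ y
      gcongr
      rw [hP']
      have : 0 ≤ 3 * Real.exp 1 * P := by positivity
      linarith
    · have := hΛ y
      gcongr
      rw [hP']
      linarith
  -- Expansion to order `k` suffices: the residual `ε^{2k}` divided by `ε^{k+1}` is at most `1`.
  have e1 : layerWeight k ε x / ε ^ (k + 1) ≤ 1 + layer ε x / ε ^ k := by
    have e2 : layerWeight k ε x / ε ^ (k + 1) = ε ^ (k - 1) + layer ε x / ε ^ k := by
      have : ε ^ (2 * k) = ε ^ (k - 1) * ε ^ (k + 1) := by rw [← pow_add]; congr 1; omega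
      rw [layerWeight, this]
      field_simp
      ring
    rw [e2]
    gcongr
    exact pow_le_one₀ hε.le hε1.le
  have e3 : iteratedDerivWithin (k + 1) u (Icc 0 1) x =
      iteratedDerivWithin (k + 1) w (Icc 0 1) x + iteratedDerivWithin (k + 1) S (Icc 0 1) x := by
    rw [hsub (k + 1) le_rfl x hx]; ring
  have e4 : 0 ≤ layer ε x / ε ^ k := by have := layer_pos ε x; positivity
  rw [e3]
  calc _ ≤ _ := abs_add_le _ _
    _ ≤ A * (1 + layer ε x / ε ^ k) + K := by
      have := hx2.trans (mul_le_mul_of_nonneg_left e1 hA0)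
      have := hSb (k + 1) le_rfl x hx
      linarith
    _ ≤ _ := by nlinarith

/-! ### Polynomial approximation on one cell -/

/-- The Cauchy–Schwarz inequality for the integral of a continuous function. -/
theorem sq_integral_le {a b : ℝ} (hab : a < b) {f : ℝ → ℝ} (hf : ContinuousOn f (Icc a b)) :
    (∫ x in a..b, f x) ^ 2 ≤ (b - a) * ∫ x in a..b, f x ^ 2 := by
  have hi : IntervalIntegrable f MeasureTheory.volume a b := hf.intervalIntegrable_of_Icc hab.le
  have hi2 : IntervalIntegrable (fun x => f x ^ 2) MeasureTheory.volume a b :=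
    (hf.pow 2).intervalIntegrable_of_Icc hab.le
  set I := ∫ x in a..b, f x with hI
  -- The inequality is the nonnegativity of the integral of `(f - m)²`, with `m` the mean value.
  set m := I / (b - a) with hm
  have hba : 0 < b - a := sub_pos.2 hab
  have h1 : ∫ x in a..b, (f x - m) ^ 2 = (∫ x in a..b, f x ^ 2) - 2 * m * I + m ^ 2 * (b - a) := by
    have : ∀ x, (f x - m) ^ 2 = f x ^ 2 - 2 * m * f x + m ^ 2 := fun x => by ring
    simp only [this]
    rw [intervalIntegral.integral_add (hi2.sub (hi.const_mul _)) (by simp),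
      intervalIntegral.integral_sub hi2 (hi.const_mul _),
      intervalIntegral.integral_const_mul, intervalIntegral.integral_const, smul_eq_mul, ← hI]
    ring
  have h2 : 0 ≤ ∫ x in a..b, (f x - m) ^ 2 :=
    intervalIntegral.integral_nonneg hab.le fun x _ => sq_nonneg _
  rw [h1] at h2
  have h3 : m * (b - a) = I := by rw [hm]; field_simp
  have h4 : 0 ≤ (b - a) * ((∫ x in a..b, f x ^ 2) - 2 * m * I + m ^ 2 * (b - a)) :=
    mul_nonneg hba.le h2
  have h5 : (b - a) * ((∫ x in a..b, f x ^ 2) - 2 * m * I + m ^ 2 * (b - a)) =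
      (b - a) * (∫ x in a..b, f x ^ 2) - I ^ 2 := by
    linear_combination (m * (b - a) - I) * h3
  linarith

theorem integral_eq_sub_of_hasDerivWithinAt {a b x : ℝ} {e e1 : ℝ → ℝ}
    (he : ∀ x ∈ Icc a b, HasDerivWithinAt e (e1 x) (Icc a b) x)
    (he1 : ContinuousOn e1 (Icc a b)) (hx : x ∈ Icc a b) :
    ∫ y in a..x, e1 y = e x - e a := by
  have hsub : Icc a x ⊆ Icc a b := Icc_subset_Icc_right hx.2
  refine intervalIntegral.integral_eq_sub_of_hasDerivAt_of_le hx.1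
    (fun y hy => ((he y (hsub hy)).continuousWithinAt).mono hsub) (fun y hy => ?_)
    ((he1.mono hsub).intervalIntegrable_of_Icc hx.1)
  exact (he y (hsub (Ioo_subset_Icc_self hy))).hasDerivAt
    (Icc_mem_nhds hy.1 (hy.2.trans_le hx.2))

/-- The oscillation of a function is bounded by the integral of the derivative. -/
theorem abs_sub_le_integral_abs_deriv {a b x y : ℝ} {e e1 : ℝ → ℝ}
    (he : ∀ x ∈ Icc a b, HasDerivWithinAt e (e1 x) (Icc a b) x)
    (he1 : ContinuousOn e1 (Icc a b)) (hx : x ∈ Icc a b) (hy : y ∈ Icc a b) :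
    |e x - e y| ≤ ∫ z in a..b, |e1 z| := by
  have hab : a ≤ b := hx.1.trans hx.2
  have hint : ∀ z ∈ Icc a b, IntervalIntegrable e1 MeasureTheory.volume a z := fun z hz =>
    (he1.mono (Icc_subset_Icc_right hz.2)).intervalIntegrable_of_Icc hz.1
  have h1 : e x - e y = ∫ z in y..x, e1 z := by
    rw [← intervalIntegral.integral_interval_sub_left (hint x hx) (hint y hy),
      integral_eq_sub_of_hasDerivWithinAt he he1 hx, integral_eq_sub_of_hasDerivWithinAt he he1 hy]
    ring
  rw [h1, ← Real.norm_eq_abs]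
  refine (intervalIntegral.norm_integral_le_abs_integral_norm).trans ?_
  have h2 := intervalIntegral.abs_integral_mono_interval (f := fun z => |e1 z|)
    (a := y) (b := x) (c := a) (d := b) (μ := MeasureTheory.volume)
    (by rw [uIoc_of_le hab, uIoc]; exact Ioc_subset_Ioc (le_min hy.1 hx.1) (max_le hy.2 hx.2))
    (Filter.Eventually.of_forall fun z => abs_nonneg _)
    (he1.abs.intervalIntegrable_of_Icc hab)
  refine h2.trans (le_of_eq ?_)
  exact abs_of_nonneg (intervalIntegral.integral_nonneg hab fun z _ => abs_nonneg _)

/-- A function of mean value zero is bounded by the integral of its derivative. -/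
theorem abs_le_integral_abs_deriv_of_integral_eq_zero {a b : ℝ} (hab : a < b) {e e1 : ℝ → ℝ}
    (he : ∀ x ∈ Icc a b, HasDerivWithinAt e (e1 x) (Icc a b) x)
    (he1 : ContinuousOn e1 (Icc a b)) (h0 : ∫ x in a..b, e x = 0) :
    ∀ x ∈ Icc a b, |e x| ≤ ∫ z in a..b, |e1 z| := by
  intro x hx
  -- Mean value zero provides a zero of `e`, from which the oscillation bound starts.
  obtain ⟨y, hy, hy0⟩ := exists_eq_interval_average hab.ne (f := e) (by
    rw [uIcc_of_le hab.le]; exact fun y hy => (he y hy).continuousWithinAt)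
  rw [interval_average_eq, h0, smul_zero] at hy0
  rw [uIoo_of_le hab.le] at hy
  simpa [hy0] using abs_sub_le_integral_abs_deriv he he1 hx (Ioo_subset_Icc_self hy)

theorem exists_polynomial_antiderivative {n : ℕ} {q : Polynomial ℝ} (hq : q.natDegree ≤ n) :
    ∃ Q : Polynomial ℝ, Q.natDegree ≤ n + 1 ∧ Polynomial.derivative Q = q := by
  refine ⟨∑ i ∈ Finset.range (n + 1),
    Polynomial.C (q.coeff i / (i + 1)) * Polynomial.X ^ (i + 1), ?_, ?_⟩
  · refine Polynomial.natDegree_sum_le_of_forall_le _ _ fun i hi => ?_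
    refine (Polynomial.natDegree_C_mul_X_pow_le _ _).trans ?_
    have := Finset.mem_range.1 hi
    omega
  · rw [Polynomial.derivative_sum]
    conv_rhs => rw [q.as_sum_range_C_mul_X_pow' (Nat.lt_succ_of_le hq)]
    refine Finset.sum_congr rfl fun i _ => ?_
    rw [Polynomial.derivative_C_mul_X_pow, Nat.add_sub_cancel]
    congr 2
    push_cast
    field_simp

theorem integral_abs_le_of_abs_le {a b K : ℝ} (hab : a ≤ b) {e : ℝ → ℝ}
    (he : ContinuousOn e (Icc a b)) (hK : ∀ x ∈ Icc a b, |e x| ≤ K) :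
    ∫ x in a..b, |e x| ≤ (b - a) * K := by
  have hi : IntervalIntegrable (fun x => |e x|) MeasureTheory.volume a b :=
    he.abs.intervalIntegrable_of_Icc hab
  have := intervalIntegral.integral_mono_on hab hi (g := fun _ => K) (by simp) hK
  simpa using this

theorem exists_const_integral_sub_eq_zero {a b : ℝ} (hab : a < b) {g : ℝ → ℝ}
    (hg : ContinuousOn g (Icc a b)) (Q : Polynomial ℝ) :
    ∃ d : ℝ, ∫ x in a..b, (g x - (Q + Polynomial.C d).eval x) = 0 := by
  have h1 : IntervalIntegrable (fun x => g x - Q.eval x) MeasureTheory.volume a b :=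
    (hg.sub Q.continuous.continuousOn).intervalIntegrable_of_Icc hab.le
  refine ⟨(∫ x in a..b, (g x - Q.eval x)) / (b - a), ?_⟩
  simp only [Polynomial.eval_add, Polynomial.eval_C, ← sub_sub]
  rw [intervalIntegral.integral_sub h1 (by simp), intervalIntegral.integral_const, smul_eq_mul,
    mul_div_cancel₀ _ (sub_pos.2 hab).ne', sub_self]

/-- Polynomial approximation with all error derivatives of mean value zero. -/
theorem exists_mean_zero_approx {a b : ℝ} (hab : a < b) (n : ℕ) (g : ℕ → ℝ → ℝ)
    (hg : ∀ j ≤ n, ∀ x ∈ Icc a b, HasDerivWithinAt (g j) (g (j + 1) x) (Icc a b) x)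
    (hgc : ContinuousOn (g (n + 1)) (Icc a b)) :
    ∃ q : Polynomial ℝ, q.natDegree ≤ n ∧ ∫ x in a..b, (g 0 x - q.eval x) = 0 ∧
      ∀ x ∈ Icc a b, |g 0 x - q.eval x| ≤ (b - a) ^ n * ∫ x in a..b, |g (n + 1) x| := by
  induction n generalizing g with
  | zero =>
    obtain ⟨d, hd⟩ := exists_const_integral_sub_eq_zero hab
      (fun x hx => (hg 0 le_rfl x hx).continuousWithinAt) 0
    rw [zero_add] at hd
    refine ⟨Polynomial.C d, by simp, hd, fun x hx => ?_⟩
    rw [pow_zero, one_mul]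
    exact abs_le_integral_abs_deriv_of_integral_eq_zero hab (e := fun x => g 0 x - _)
      (fun x hx => by simpa using hg 0 le_rfl x hx) hgc hd x hx
  | succ n ih =>
    have hg0' : ∀ j ≤ n + 1, ContinuousOn (g j) (Icc a b) := fun j hj x hx =>
      (hg j hj x hx).continuousWithinAt
    -- Approximate the derivative, integrate, and fix the constant by the mean value condition. Each
    -- integration gains a factor `b - a`.
    obtain ⟨q, hq, -, hqb⟩ := ih (fun j => g (j + 1)) (fun j hj => hg (j + 1) (by omega)) hgc
    obtain ⟨Q, hQ, hQd⟩ := exists_polynomial_antiderivative hq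
    obtain ⟨d, hd⟩ := exists_const_integral_sub_eq_zero hab (hg0' 0 (by omega)) Q
    refine ⟨Q + Polynomial.C d, (Polynomial.natDegree_add_C).trans_le hQ, hd, fun x hx => ?_⟩
    have hc1 : ContinuousOn (fun x => g 1 x - q.eval x) (Icc a b) :=
      (hg0' 1 (by omega)).sub q.continuous.continuousOn
    have h1 := abs_le_integral_abs_deriv_of_integral_eq_zero hab
      (e := fun x => g 0 x - (Q + Polynomial.C d).eval x) (e1 := fun x => g 1 x - q.eval x)
      (fun x hx => (hg 0 (Nat.zero_le _) x hx).sub (by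
        have := (Q + Polynomial.C d).hasDerivWithinAt x (Icc a b)
        simpa [hQd] using this)) hc1 hd x hx
    refine h1.trans ((integral_abs_le_of_abs_le hab.le hc1 hqb).trans (le_of_eq ?_))
    ring

/-- One factor `b - a` comes from integrating the constant bound, the other from Cauchy–Schwarz
applied to `|g|`. -/
theorem integral_sq_le_of_abs_le {a b r : ℝ} (hab : a < b) {e g : ℝ → ℝ}
    (he : ContinuousOn e (Icc a b)) (hg : ContinuousOn g (Icc a b))
    (hK : ∀ x ∈ Icc a b, |e x| ≤ r * ∫ x in a..b, |g x|) :
    ∫ x in a..b, e x ^ 2 ≤ ((b - a) * r) ^ 2 * ∫ x in a..b, g x ^ 2 := by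
  have hi : IntervalIntegrable (fun x => e x ^ 2) MeasureTheory.volume a b :=
    (he.pow 2).intervalIntegrable_of_Icc hab.le
  have h1 := intervalIntegral.integral_mono_on hab.le hi
    (g := fun _ => (r * ∫ x in a..b, |g x|) ^ 2) (by simp)
    (fun x hx => by
      rw [← sq_abs (e x)]
      exact pow_le_pow_left₀ (abs_nonneg _) (hK x hx) 2)
  have h2 := sq_integral_le hab hg.abs
  simp only [sq_abs] at h2
  simp only [intervalIntegral.integral_const, smul_eq_mul] at h1
  have h3 : (0 : ℝ) < b - a := sub_pos.2 hab
  refine h1.trans ?_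
  calc (b - a) * (r * ∫ x in a..b, |g x|) ^ 2 = (b - a) * r ^ 2 * (∫ x in a..b, |g x|) ^ 2 := by
        ring
    _ ≤ (b - a) * r ^ 2 * ((b - a) * ∫ x in a..b, g x ^ 2) := by gcongr
    _ = _ := by ring

/-- Interpolation on one cell, exact at the end points, with `L²` error bounds. -/
theorem exists_cell_interpolant {a b : ℝ} (hab : a < b) {k : ℕ} (hk : 1 ≤ k) (g : ℕ → ℝ → ℝ)
    (hg : ∀ j ≤ k, ∀ x ∈ Icc a b, HasDerivWithinAt (g j) (g (j + 1) x) (Icc a b) x)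
    (hgc : ContinuousOn (g (k + 1)) (Icc a b)) :
    ∃ p : Polynomial ℝ, p.natDegree ≤ k ∧ p.eval a = g 0 a ∧ p.eval b = g 0 b ∧
      ∫ x in a..b, (g 0 x - p.eval x) ^ 2 ≤
        (b - a) ^ (2 * k + 2) * ∫ x in a..b, g (k + 1) x ^ 2 ∧
      ∫ x in a..b, (g 1 x - (Polynomial.derivative p).eval x) ^ 2 ≤
        (b - a) ^ (2 * k) * ∫ x in a..b, g (k + 1) x ^ 2 := by
  obtain ⟨n, rfl⟩ : ∃ n, k = n + 1 := ⟨k - 1, by omega⟩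
  have hcont : ∀ j ≤ n + 1, ContinuousOn (g j) (Icc a b) := fun j hj x hx =>
    (hg j hj x hx).continuousWithinAt
  obtain ⟨q, hq, hq0, hqb⟩ := exists_mean_zero_approx hab n (fun j => g (j + 1))
    (fun j hj => hg (j + 1) (by omega)) hgc
  simp only [zero_add] at hq0 hqb
  obtain ⟨Q, hQ, hQd⟩ := exists_polynomial_antiderivative hq
  -- The constant makes `p` exact at `a`; exactness at `b` follows because the error of the
  -- derivative has mean value zero.
  set p := Q + Polynomial.C (g 0 a - Q.eval a) with hp
  have hpd : Polynomial.derivative p = q := by simp [hp, hQd]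
  have hpa : p.eval a = g 0 a := by simp [hp]
  have hc1 : ContinuousOn (fun x => g 1 x - q.eval x) (Icc a b) :=
    (hcont 1 (by omega)).sub q.continuous.continuousOn
  have hc0 : ContinuousOn (fun x => g 0 x - p.eval x) (Icc a b) :=
    (hcont 0 (by omega)).sub p.continuous.continuousOn
  have hde : ∀ x ∈ Icc a b,
      HasDerivWithinAt (fun x => g 0 x - p.eval x) (g 1 x - q.eval x) (Icc a b) x :=
    fun x hx => (hg 0 (Nat.zero_le _) x hx).sub (hpd ▸ p.hasDerivWithinAt x (Icc a b))
  have hpb : p.eval b = g 0 b := by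
    have := integral_eq_sub_of_hasDerivWithinAt hde hc1 (right_mem_Icc.2 hab.le)
    rw [hq0, hpa] at this
    linarith
  refine ⟨p, (Polynomial.natDegree_add_C).trans_le hQ, hpa, hpb, ?_, ?_⟩
  · have h1 : ∀ x ∈ Icc a b, |g 0 x - p.eval x| ≤
        (b - a) ^ (n + 1) * ∫ x in a..b, |g (n + 1 + 1) x| := by
      intro x hx
      have h2 := abs_sub_le_integral_abs_deriv hde hc1 hx (left_mem_Icc.2 hab.le)
      simp only [hpa, sub_self, sub_zero] at h2
      refine h2.trans ((integral_abs_le_of_abs_le hab.le hc1 hqb).trans (le_of_eq ?_))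
      ring
    refine (integral_sq_le_of_abs_le hab hc0 hgc
      h1).trans (le_of_eq ?_)
    ring
  · rw [hpd]
    refine (integral_sq_le_of_abs_le hab hc1 hgc
      hqb).trans (le_of_eq ?_)
    ring

/-! ### Gluing, piecewise smooth functions and the energy argument -/

/-- Continuous functions on adjacent cells that agree at the nodes can be glued. -/
theorem exists_glue {n : ℕ} (hn : 0 < n) {x : ℕ → ℝ} (hx : ∀ i < n, x i < x (i + 1))
    {P : ℕ → ℝ → ℝ} (hP : ∀ i, Continuous (P i))
    (hPx : ∀ i, i + 1 < n → P i (x (i + 1)) = P (i + 1) (x (i + 1))) :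
    ∃ v : ℝ → ℝ, ContinuousOn v (Icc (x 0) (x n)) ∧
      ∀ i < n, ∀ y ∈ Icc (x i) (x (i + 1)), v y = P i y := by
  induction n, hn using Nat.le_induction with
  | base =>
    exact ⟨P 0, (hP 0).continuousOn, fun i hi y _ => by
      obtain rfl : i = 0 := by omega
      rfl⟩
  | succ n hn ih =>
    obtain ⟨v, hv, hvP⟩ := ih (fun i hi => hx i (by omega)) (fun i hi => hPx i (by omega))
    have hmono : ∀ i j, i ≤ j → j ≤ n + 1 → x i ≤ x j := by
      intro i j hij
      induction j, hij using Nat.le_induction with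
      | base => exact fun _ => le_rfl
      | succ j _ ihj => exact fun hj => (ihj (by omega)).trans (hx j (by omega)).le
    have hnode : v (x n) = P n (x n) := by
      obtain ⟨m, rfl⟩ : ∃ m, n = m + 1 := ⟨n - 1, by omega⟩
      rw [hvP m (by omega) _ (right_mem_Icc.2 (hx m (by omega)).le), hPx m (by omega)]
    have hright : ∀ y, x n ≤ y → (if y ≤ x n then v y else P n y) = P n y := by
      intro y hy
      split_ifs with h
      · rw [le_antisymm h hy, hnode]
      · rfl
    refine ⟨fun y => if y ≤ x n then v y else P n y, ?_, ?_⟩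
    · have h1 : Icc (x 0) (x (n + 1)) = Icc (x 0) (x n) ∪ Icc (x n) (x (n + 1)) :=
        (Icc_union_Icc_eq_Icc (hmono 0 n (by omega) (by omega)) (hx n (by omega)).le).symm
      rw [h1]
      refine ContinuousOn.union_of_isClosed ?_ ?_ isClosed_Icc isClosed_Icc
      · exact hv.congr fun y hy => if_pos hy.2
      · exact (hP n).continuousOn.congr fun y hy => hright y hy.1
    · intro i hi y hy
      rcases Nat.lt_succ_iff_lt_or_eq.1 hi with h | rfl
      · have : y ≤ x n := hy.2.trans (hmono (i + 1) n (by omega) (by omega))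
        simp only [if_pos this]
        exact hvP i h y hy
      · exact hright y hy.1

/-- Continuous, piecewise differentiable functions on the unit interval with bounded
derivative. -/
structure IsPiecewiseC1 (v : ℝ → ℝ) : Prop where
  cont : ContinuousOn v (Icc 0 1)
  diff : ∃ Z : Set ℝ, Z.Finite ∧ ∃ K : ℝ, ∀ x ∈ Ioo (0 : ℝ) 1 \ Z,
    DifferentiableAt ℝ v x ∧ |deriv v x| ≤ K

namespace IsPiecewiseC1

variable {v w z : ℝ → ℝ}

theorem ae_diff (hv : IsPiecewiseC1 v) :
    ∃ K : ℝ, ∀ᵐ x ∂MeasureTheory.volume.restrict (uIoc (0 : ℝ) 1),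
      DifferentiableAt ℝ v x ∧ |deriv v x| ≤ K := by
  obtain ⟨Z, hZ, K, hK⟩ := hv.diff
  refine ⟨K, ?_⟩
  rw [uIoc_of_le zero_le_one, MeasureTheory.ae_restrict_iff' measurableSet_Ioc]
  -- `1` joins the null set: the interval of integration contains it, while the bound holds only on
  -- the open interval.
  filter_upwards [(hZ.insert 1).countable.ae_notMem MeasureTheory.volume] with x hx hx1
  rw [mem_insert_iff, not_or] at hx
  exact hK x ⟨⟨hx1.1, lt_of_le_of_ne hx1.2 hx.1⟩, hx.2⟩

theorem sub (hv : IsPiecewiseC1 v) (hw : IsPiecewiseC1 w) :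
    IsPiecewiseC1 (fun x => v x - w x) := by
  obtain ⟨Z, hZ, K, hK⟩ := hv.diff
  obtain ⟨Z', hZ', K', hK'⟩ := hw.diff
  refine ⟨hv.cont.sub hw.cont, Z ∪ Z', hZ.union hZ', K + K', fun x hx => ?_⟩
  obtain ⟨h1, h2⟩ := hK x ⟨hx.1, fun h => hx.2 (Or.inl h)⟩
  obtain ⟨h3, h4⟩ := hK' x ⟨hx.1, fun h => hx.2 (Or.inr h)⟩
  refine ⟨h1.sub h3, ?_⟩
  rw [deriv_fun_sub h1 h3]
  exact (abs_sub _ _).trans (add_le_add h2 h4)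

/-- `deriv` is always measurable, so almost everywhere boundedness is enough. -/
theorem intervalIntegrable_deriv_mul_deriv (hv : IsPiecewiseC1 v) (hw : IsPiecewiseC1 w) :
    IntervalIntegrable (fun x => deriv v x * deriv w x) MeasureTheory.volume 0 1 := by
  obtain ⟨K, hK⟩ := hv.ae_diff
  obtain ⟨K', hK'⟩ := hw.ae_diff
  rw [intervalIntegrable_iff]
  refine MeasureTheory.Measure.integrableOn_of_bounded (M := K * K')
    (by simp) ((measurable_deriv v).mul (measurable_deriv w)).aestronglyMeasurable ?_
  filter_upwards [hK, hK'] with x h1 h2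
  rw [Real.norm_eq_abs, abs_mul]
  exact mul_le_mul h1.2 h2.2 (abs_nonneg _) ((abs_nonneg _).trans h1.2)

theorem intervalIntegrable_mul_mul {c : ℝ → ℝ} (hc : ContinuousOn c (Icc 0 1))
    (hv : IsPiecewiseC1 v) (hw : IsPiecewiseC1 w) :
    IntervalIntegrable (fun x => c x * v x * w x) MeasureTheory.volume 0 1 :=
  ((hc.mul hv.cont).mul hw.cont).intervalIntegrable_of_Icc zero_le_one

end IsPiecewiseC1

theorem bilin_comm (ε : ℝ) (c v w : ℝ → ℝ) : bilin ε c v w = bilin ε c w v := by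
  unfold bilin
  simp only [mul_comm (deriv v _), mul_right_comm _ (v _)]

theorem bilin_sub_left {ε : ℝ} {c v w z : ℝ → ℝ} (hc : ContinuousOn c (Icc 0 1))
    (hv : IsPiecewiseC1 v) (hw : IsPiecewiseC1 w) (hz : IsPiecewiseC1 z) :
    bilin ε c (fun x => v x - w x) z = bilin ε c v z - bilin ε c w z := by
  obtain ⟨K, hK⟩ := hv.ae_diff
  obtain ⟨K', hK'⟩ := hw.ae_diff
  have h1 : ∫ x in (0 : ℝ)..1, deriv (fun x => v x - w x) x * deriv z x =
      (∫ x in (0 : ℝ)..1, deriv v x * deriv z x) - ∫ x in (0 : ℝ)..1, deriv w x * deriv z x := by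
    rw [← intervalIntegral.integral_sub (hv.intervalIntegrable_deriv_mul_deriv hz)
      (hw.intervalIntegrable_deriv_mul_deriv hz)]
    refine intervalIntegral.integral_congr_ae_restrict ?_
    filter_upwards [hK, hK'] with x h2 h3
    rw [deriv_fun_sub h2.1 h3.1]
    ring
  have h2 : ∫ x in (0 : ℝ)..1, c x * (v x - w x) * z x =
      (∫ x in (0 : ℝ)..1, c x * v x * z x) - ∫ x in (0 : ℝ)..1, c x * w x * z x := by
    rw [← intervalIntegral.integral_sub (hv.intervalIntegrable_mul_mul hc hz)
      (hw.intervalIntegrable_mul_mul hc hz)]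
    congr 1; ext x; ring
  unfold bilin
  rw [h1, h2]
  ring

theorem bilin_sub_self {ε : ℝ} {c v w : ℝ → ℝ} (hc : ContinuousOn c (Icc 0 1))
    (hv : IsPiecewiseC1 v) (hw : IsPiecewiseC1 w) :
    bilin ε c (fun x => v x - w x) (fun x => v x - w x) =
      bilin ε c v v - 2 * bilin ε c v w + bilin ε c w w := by
  have hs := hv.sub hw
  rw [bilin_sub_left hc hv hw hs, bilin_comm ε c v, bilin_comm ε c w,
    bilin_sub_left hc hv hw hv, bilin_sub_left hc hv hw hw, bilin_comm ε c w v]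
  ring

theorem integral_deriv_sq_nonneg (v : ℝ → ℝ) : 0 ≤ ∫ x in (0 : ℝ)..1, deriv v x ^ 2 :=
  intervalIntegral.integral_nonneg zero_le_one fun _ _ => sq_nonneg _

theorem bilin_self_nonneg {ε : ℝ} {c v : ℝ → ℝ} (hc1 : ∀ x ∈ Icc (0 : ℝ) 1, 1 < c x) :
    0 ≤ bilin ε c v v := by
  refine add_nonneg (mul_nonneg (sq_nonneg _) ?_) ?_
  · exact intervalIntegral.integral_nonneg zero_le_one fun _ _ => mul_self_nonneg _
  · refine intervalIntegral.integral_nonneg zero_le_one fun x hx => ?_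
    rw [mul_assoc]
    exact mul_nonneg (zero_lt_one.trans (hc1 x hx)).le (mul_self_nonneg _)

theorem le_bilin_self {ε : ℝ} {c v : ℝ → ℝ} (hc : ContinuousOn c (Icc 0 1))
    (hc1 : ∀ x ∈ Icc (0 : ℝ) 1, 1 < c x) (hv : IsPiecewiseC1 v) :
    ε ^ 2 * (∫ x in (0 : ℝ)..1, deriv v x ^ 2) + ∫ x in (0 : ℝ)..1, v x ^ 2 ≤
      bilin ε c v v := by
  unfold bilin
  simp only [sq (deriv v _)]
  have hi : IntervalIntegrable (fun x => v x ^ 2) MeasureTheory.volume 0 1 :=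
    (hv.cont.pow 2).intervalIntegrable_of_Icc zero_le_one
  have := intervalIntegral.integral_mono_on zero_le_one hi
    (hv.intervalIntegrable_mul_mul hc hv) (fun x hx => by
      nlinarith [hc1 x hx, sq_nonneg (v x)])
  linarith

theorem bilin_self_le {ε B : ℝ} {c v : ℝ → ℝ} (hc : ContinuousOn c (Icc 0 1))
    (hcB : ∀ x ∈ Icc (0 : ℝ) 1, c x ≤ B) (hv : IsPiecewiseC1 v) :
    bilin ε c v v ≤
      ε ^ 2 * (∫ x in (0 : ℝ)..1, deriv v x ^ 2) + B * ∫ x in (0 : ℝ)..1, v x ^ 2 := by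
  unfold bilin
  simp only [sq (deriv v _)]
  have hi : IntervalIntegrable (fun x => B * v x ^ 2) MeasureTheory.volume 0 1 :=
    ((hv.cont.pow 2).intervalIntegrable_of_Icc zero_le_one).const_mul B
  have := intervalIntegral.integral_mono_on zero_le_one
    (hv.intervalIntegrable_mul_mul hc hv) hi (fun x hx => by
      nlinarith [hcB x hx, sq_nonneg (v x)])
  rw [intervalIntegral.integral_const_mul] at this
  linarith

theorem IsNeumannSolution.isPiecewiseC1 {ε : ℝ} {c f u : ℝ → ℝ}
    (hu : IsNeumannSolution ε c f u) : IsPiecewiseC1 u := by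
  have hs := uniqueDiffOn_Icc_zero_one
  obtain ⟨K, hK⟩ := isCompact_Icc.exists_bound_of_continuousOn
    (hu.contDiffOn.continuousOn_derivWithin hs (by norm_num))
  refine ⟨hu.contDiffOn.continuousOn, ∅, finite_empty, K, fun x hx => ?_⟩
  have hn : Icc (0 : ℝ) 1 ∈ nhds x := Icc_mem_nhds hx.1.1 hx.1.2
  refine ⟨(hu.contDiffOn.contDiffAt hn).differentiableAt two_ne_zero, ?_⟩
  rw [← derivWithin_of_mem_nhds hn]
  exact hK x (Ioo_subset_Icc_self hx.1)

/-- A classical solution of the Neumann problem is a weak solution. -/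
theorem IsNeumannSolution.bilin_eq {ε : ℝ} {c f u v : ℝ → ℝ} (hε : 0 < ε)
    (hu : IsNeumannSolution ε c f u)
    (hc : ContinuousOn c (Icc 0 1)) (hf : ContinuousOn f (Icc 0 1)) (hv : IsPiecewiseC1 v) :
    bilin ε c u v = ∫ x in (0 : ℝ)..1, f x * v x := by
  have hs := uniqueDiffOn_Icc_zero_one
  have hu2 := hu.iteratedDerivWithin_two hε hc hf
  have hcu := hu.contDiffOn.continuousOn
  obtain ⟨Z, hZ, K, hK⟩ := hv.diff
  -- Unlike `deriv u`, whose endpoint values depend on `u` outside `[0,1]`, this derivative is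
  -- continuous up to the boundary.
  set u1 := iteratedDerivWithin 1 u (Icc 0 1) with hu1
  have hu1c : ContinuousOn u1 (Icc 0 1) :=
    hu.contDiffOn.continuousOn_iteratedDerivWithin (by norm_num) hs
  have hd0 : ∀ x ∈ Ioo (0 : ℝ) 1, deriv u x = u1 x := by
    intro x hx
    rw [hu1, iteratedDerivWithin_one, derivWithin_of_mem_nhds (Icc_mem_nhds hx.1 hx.2)]
  have hd1 : ∀ x ∈ Ioo (0 : ℝ) 1, HasDerivAt u1 ((c x * u x - f x) / ε ^ 2) x := by
    intro x hx
    have hx' := Ioo_subset_Icc_self hx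
    have := hasDerivWithinAt_iteratedDerivWithin (n := 2) (j := 1) hs
      (by exact_mod_cast hu.contDiffOn) (by norm_num) hx'
    rw [← hu2 x hx']
    exact this.hasDerivAt (Icc_mem_nhds hx.1 hx.2)
  have hi1 : IntervalIntegrable (fun x => (c x * u x - f x) / ε ^ 2 * v x)
      MeasureTheory.volume 0 1 :=
    ((((hc.mul hcu).sub hf).div_const _).mul hv.cont).intervalIntegrable_of_Icc zero_le_one
  have hi2 : IntervalIntegrable (fun x => u1 x * deriv v x) MeasureTheory.volume 0 1 :=
    (hu.isPiecewiseC1.intervalIntegrable_deriv_mul_deriv hv).congr_uIoo (fun x hx => by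
      rw [uIoo_of_le zero_le_one] at hx
      simp only [hd0 x hx])
  -- Integration by parts for `u' v`, with the kinks of `v` as exceptional set; the Neumann
  -- conditions remove the boundary terms.
  have h1 := MeasureTheory.integral_eq_of_hasDerivAt_off_countable_of_le
    (fun x => u1 x * v x) (fun x => (c x * u x - f x) / ε ^ 2 * v x + u1 x * deriv v x)
    zero_le_one hZ.countable (hu1c.mul hv.cont)
    (fun x hx => (hd1 x hx.1).mul (hK x hx).1.hasDerivAt) (hi1.add hi2)
  have hu10 : u1 0 = 0 := by rw [hu1, iteratedDerivWithin_one, hu.left]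
  have hu11 : u1 1 = 0 := by rw [hu1, iteratedDerivWithin_one, hu.right]
  rw [intervalIntegral.integral_add hi1 hi2, hu10, hu11] at h1
  have h2 : ∫ x in (0 : ℝ)..1, deriv u x * deriv v x = ∫ x in (0 : ℝ)..1, u1 x * deriv v x :=
    intervalIntegral.integral_congr_Ioo_of_le zero_le_one fun x hx => by
      simp only [hd0 x hx]
  have hi3 : IntervalIntegrable (fun x => c x * u x * v x) MeasureTheory.volume 0 1 :=
    hu.isPiecewiseC1.intervalIntegrable_mul_mul hc hv
  have hi4 : IntervalIntegrable (fun x => f x * v x) MeasureTheory.volume 0 1 :=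
    (hf.mul hv.cont).intervalIntegrable_of_Icc zero_le_one
  have h3 : ∫ x in (0 : ℝ)..1, (c x * u x - f x) / ε ^ 2 * v x =
      ((∫ x in (0 : ℝ)..1, c x * u x * v x) - ∫ x in (0 : ℝ)..1, f x * v x) / ε ^ 2 := by
    rw [← intervalIntegral.integral_sub hi3 hi4, ← intervalIntegral.integral_div]
    congr 1; ext x; ring
  rw [h3] at h1
  unfold bilin
  rw [h2]
  field_simp at h1
  linarith

/-- Quasi-optimality of the finite element solution. -/
theorem IsGalerkinSolution.error_le {ε B : ℝ} {c f u uh v : ℝ → ℝ} {V : Set (ℝ → ℝ)} (hε : 0 < ε)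
    (hu : IsNeumannSolution ε c f u) (huh : IsGalerkinSolution ε c f V uh)
    (hc : ContinuousOn c (Icc 0 1)) (hf : ContinuousOn f (Icc 0 1))
    (hc1 : ∀ x ∈ Icc (0 : ℝ) 1, 1 < c x) (hcB : ∀ x ∈ Icc (0 : ℝ) 1, c x ≤ B)
    (hV : ∀ v ∈ V, IsPiecewiseC1 v) (hVsub : ∀ v ∈ V, ∀ w ∈ V, (fun x => v x - w x) ∈ V)
    (hv : v ∈ V) :
    ε ^ 2 * (∫ x in (0 : ℝ)..1, deriv (fun x => u x - uh x) x ^ 2) +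
        ∫ x in (0 : ℝ)..1, (u x - uh x) ^ 2 ≤
      ε ^ 2 * (∫ x in (0 : ℝ)..1, deriv (fun x => u x - v x) x ^ 2) +
        B * ∫ x in (0 : ℝ)..1, (u x - v x) ^ 2 := by
  have hu' := hu.isPiecewiseC1
  have huh' := hV uh huh.1
  have hv' := hV v hv
  have hφV := hVsub v hv uh huh.1
  have hφ := hV _ hφV
  have he := hu'.sub huh'
  have horth : bilin ε c (fun x => u x - uh x) (fun x => v x - uh x) = 0 := by
    rw [bilin_sub_left hc hu' huh' hφ, hu.bilin_eq hε hc hf hφ, huh.2 _ hφV, sub_self]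
  -- Pythagoras: by orthogonality the energy of `u - v` is that of `u - uh` plus that of `v - uh`.
  have h1 := bilin_sub_self (ε := ε) hc he hφ
  have h2 : (fun x => (u x - uh x) - (v x - uh x)) = fun x => u x - v x := by ext x; ring
  rw [h2, horth] at h1
  have h3 := bilin_self_nonneg (ε := ε) (v := fun x => v x - uh x) hc1
  calc _ ≤ _ := le_bilin_self hc hc1 he
    _ ≤ bilin ε c (fun x => u x - v x) (fun x => u x - v x) := by linarith
    _ ≤ _ := bilin_self_le hc hcB (hu'.sub hv')

theorem energyNorm_le {ε X : ℝ} {v : ℝ → ℝ} (hε : 0 < ε) (hX : 0 ≤ X)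
    (h : ε ^ 2 * (∫ x in (0 : ℝ)..1, deriv v x ^ 2) + ∫ x in (0 : ℝ)..1, v x ^ 2 ≤ X ^ 2) :
    energyNorm ε v ≤ 2 * X := by
  have h1 := integral_deriv_sq_nonneg v
  have h2 : 0 ≤ ∫ x in (0 : ℝ)..1, v x ^ 2 :=
    intervalIntegral.integral_nonneg zero_le_one fun _ _ => sq_nonneg _
  have h3 : ε * seminormH1 v ≤ X := by
    refine abs_le_of_sq_le_sq' ?_ hX |>.2
    rw [mul_pow, seminormH1, normL2, Real.sq_sqrt h1]
    linarith
  have h4 : normL2 v ≤ X := by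
    refine abs_le_of_sq_le_sq' ?_ hX |>.2
    rw [normL2, Real.sq_sqrt h2]
    have : 0 ≤ ε ^ 2 * ∫ x in (0 : ℝ)..1, deriv v x ^ 2 := by positivity
    linarith
  unfold energyNorm
  linarith

/-! ### The mesh and the finite element space -/

theorem exists_mem_cell {n : ℕ} (hn : 0 < n) {x : ℕ → ℝ} {y : ℝ} (hy : y ∈ Icc (x 0) (x n)) :
    ∃ i < n, y ∈ Icc (x i) (x (i + 1)) := by
  induction n, hn using Nat.le_induction with
  | base => exact ⟨0, zero_lt_one, hy⟩
  | succ n _ ih =>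
    rcases le_total y (x n) with h | h
    · obtain ⟨i, hi, hyi⟩ := ih ⟨hy.1, h⟩
      exact ⟨i, by omega, hyi⟩
    · exact ⟨n, by omega, h, hy.2⟩

theorem isPiecewiseC1_of_polynomial {n : ℕ} (hn : 0 < n) {x : ℕ → ℝ} (hx0 : x 0 = 0)
    (hx1 : x n = 1) {v : ℝ → ℝ} (hv : ContinuousOn v (Icc 0 1))
    (hp : ∀ i < n, ∃ p : Polynomial ℝ, ∀ y ∈ Icc (x i) (x (i + 1)), v y = p.eval y) :
    IsPiecewiseC1 v := by
  choose! p hp using hp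
  have hB : ∀ i, ∃ B : ℝ, ∀ y ∈ Icc (0 : ℝ) 1, |(Polynomial.derivative (p i)).eval y| ≤ B :=
    fun i => isCompact_Icc.exists_bound_of_continuousOn (Polynomial.continuous _).continuousOn
  choose B hB using hB
  have hB0 : ∀ i, 0 ≤ B i := fun i => (abs_nonneg _).trans (hB i 0 (by simp))
  refine ⟨hv, x '' Iic n, (finite_Iic n).image x, ∑ i ∈ Finset.range n, B i, fun y hy => ?_⟩
  obtain ⟨i, hi, hyi⟩ := exists_mem_cell hn (x := x) (y := y)
    (by rw [hx0, hx1]; exact Ioo_subset_Icc_self hy.1)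
  have h1 : x i ≠ y := fun h => hy.2 ⟨i, hi.le, h⟩
  have h2 : x (i + 1) ≠ y := fun h => hy.2 ⟨i + 1, hi, h⟩
  have hn : Icc (x i) (x (i + 1)) ∈ nhds y :=
    Icc_mem_nhds (lt_of_le_of_ne hyi.1 h1) (lt_of_le_of_ne hyi.2 h2.symm)
  have he : v =ᶠ[nhds y] fun y => (p i).eval y := by
    filter_upwards [hn] with z hz using hp i hi z hz
  refine ⟨he.differentiableAt_iff.2 (p i).differentiableAt, ?_⟩
  rw [he.deriv_eq, Polynomial.deriv]
  exact (hB i y (Ioo_subset_Icc_self hy.1)).trans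
    (Finset.single_le_sum (fun j _ => hB0 j) (Finset.mem_range.2 hi))

theorem sub_mem_feSpace {k N M : ℕ} {τ : ℝ} {v w : ℝ → ℝ} (hv : v ∈ feSpace k τ N M)
    (hw : w ∈ feSpace k τ N M) : (fun x => v x - w x) ∈ feSpace k τ N M := by
  refine ⟨hv.1.sub hw.1, fun i hi => ?_⟩
  obtain ⟨p, hp, hpv⟩ := hv.2 i hi
  obtain ⟨q, hq, hqw⟩ := hw.2 i hi
  refine ⟨p - q, (Polynomial.natDegree_sub_le _ _).trans (max_le hp hq), fun x hx => ?_⟩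
  simp only [hpv x hx, hqw x hx, Polynomial.eval_sub]

section Mesh

variable {τ : ℝ} {N M : ℕ}

theorem meshNode_left {i : ℕ} (hi : i ≤ N) : meshNode τ N M i = i * (τ / N) := by
  rw [meshNode, if_pos hi]

/-- The formulas of adjacent regions agree at the shared node, so this one also holds at `i = N`,
where the definition takes the left branch. -/
theorem meshNode_middle (hN : 0 < N) {i : ℕ} (hi : N ≤ i) (hi' : i ≤ N + M) :
    meshNode τ N M i = τ + ((i : ℝ) - N) * ((1 - 2 * τ) / M) := by
  rcases hi.eq_or_lt with rfl | h
  · rw [meshNode_left le_rfl]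
    field_simp
    ring
  · rw [meshNode, if_neg (by omega), if_pos hi']

theorem meshNode_right (hN : 0 < N) (hM : 0 < M) {i : ℕ} (hi : N + M ≤ i) :
    meshNode τ N M i = 1 - τ + ((i : ℝ) - N - M) * (τ / N) := by
  rcases hi.eq_or_lt with rfl | h
  · rw [meshNode_middle hN (by omega) le_rfl]
    push_cast
    field_simp
    ring
  · rw [meshNode, if_neg (by omega), if_neg (by omega)]

theorem meshNode_zero : meshNode τ N M 0 = 0 := by simp [meshNode]

theorem meshNode_last (hN : 0 < N) (hM : 0 < M) : meshNode τ N M (2 * N + M) = 1 := by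
  rw [meshNode_right hN hM (by omega)]
  push_cast
  field_simp
  ring

/-- A cell is either a cell of length `τ / N`, or a cell of length `(1 - 2τ) / M` contained in
the middle region. -/
theorem meshNode_cell (hN : 0 < N) (hM : 0 < M) (hτ : 2 * τ < 1) (i : ℕ) :
    meshNode τ N M (i + 1) - meshNode τ N M i = τ / N ∨
      (meshNode τ N M (i + 1) - meshNode τ N M i = (1 - 2 * τ) / M ∧
        Icc (meshNode τ N M i) (meshNode τ N M (i + 1)) ⊆ Icc τ (1 - τ)) := by
  rcases lt_or_ge i N with h | h
  · left
    rw [meshNode_left h, meshNode_left h.le]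
    push_cast; ring
  rcases lt_or_ge i (N + M) with h' | h'
  · right
    rw [meshNode_middle hN (by omega) (by omega), meshNode_middle hN h h'.le]
    have hM' : (0 : ℝ) < M := by exact_mod_cast hM
    have h1 : (0 : ℝ) ≤ (1 - 2 * τ) / M := div_nonneg (by linarith) hM'.le
    have h2 : (N : ℝ) ≤ i := by exact_mod_cast h
    have h3 : ((i + 1 : ℕ) : ℝ) - N ≤ M := by
      have : ((i + 1 : ℕ) : ℝ) ≤ ((N + M : ℕ) : ℝ) := by exact_mod_cast h'
      push_cast at this ⊢; linarith
    refine ⟨by push_cast; ring, Icc_subset_Icc ?_ ?_⟩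
    · nlinarith
    · have h4 : (M : ℝ) * ((1 - 2 * τ) / M) = 1 - 2 * τ := by field_simp
      have := mul_le_mul_of_nonneg_right h3 h1
      linarith
  · left
    rw [meshNode_right hN hM (by omega), meshNode_right hN hM h']
    push_cast; ring

theorem meshNode_lt (hN : 0 < N) (hM : 0 < M) (hτ0 : 0 < τ) (hτ : 2 * τ < 1) (i : ℕ) :
    meshNode τ N M i < meshNode τ N M (i + 1) := by
  have h1 : 0 < τ / N := by positivity
  have h2 : 0 < (1 - 2 * τ) / M := div_pos (by linarith) (by exact_mod_cast hM)
  rcases meshNode_cell hN hM hτ i with h | ⟨h, -⟩ <;> linarith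

end Mesh

theorem isPiecewiseC1_of_mem_feSpace {k N M : ℕ} {τ : ℝ} (hN : 0 < N) (hM : 0 < M) {v : ℝ → ℝ}
    (hv : v ∈ feSpace k τ N M) : IsPiecewiseC1 v :=
  isPiecewiseC1_of_polynomial (n := 2 * N + M) (by omega) meshNode_zero (meshNode_last hN hM) hv.1
    fun i hi => let ⟨p, _, hp⟩ := hv.2 i hi; ⟨p, hp⟩

/-! ### Global interpolation -/

/-- Piecewise polynomial interpolation on an arbitrary partition of the unit interval, with
error bounds in terms of local majorants. -/
theorem exists_piecewise_interpolant {k n : ℕ} (hk : 1 ≤ k) (hn : 0 < n) {x : ℕ → ℝ}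
    (hx0 : x 0 = 0) (hx1 : x n = 1) (hx : ∀ i < n, x i < x (i + 1)) {u G₀ G₁ : ℝ → ℝ}
    (hu : ContDiffOn ℝ (k + 1 : ℕ) u (Icc 0 1)) (hu' : IsPiecewiseC1 u)
    (hG₀ : ContinuousOn G₀ (Icc 0 1)) (hG₁ : ContinuousOn G₁ (Icc 0 1))
    (h₀ : ∀ i < n, ∀ y ∈ Icc (x i) (x (i + 1)), (x (i + 1) - x i) ^ (2 * k + 2) *
      iteratedDerivWithin (k + 1) u (Icc 0 1) y ^ 2 ≤ G₀ y)
    (h₁ : ∀ i < n, ∀ y ∈ Icc (x i) (x (i + 1)), (x (i + 1) - x i) ^ (2 * k) *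
      iteratedDerivWithin (k + 1) u (Icc 0 1) y ^ 2 ≤ G₁ y) :
    ∃ v : ℝ → ℝ, ContinuousOn v (Icc 0 1) ∧
      (∀ i < n, ∃ p : Polynomial ℝ, p.natDegree ≤ k ∧
        ∀ y ∈ Icc (x i) (x (i + 1)), v y = p.eval y) ∧
      ∫ y in (0 : ℝ)..1, (u y - v y) ^ 2 ≤ ∫ y in (0 : ℝ)..1, G₀ y ∧
      ∫ y in (0 : ℝ)..1, deriv (fun y => u y - v y) y ^ 2 ≤ ∫ y in (0 : ℝ)..1, G₁ y := by
  have hs := uniqueDiffOn_Icc_zero_one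
  have hmono : ∀ i j, i ≤ j → j ≤ n → x i ≤ x j := by
    intro i j hij
    induction j, hij using Nat.le_induction with
    | base => exact fun _ => le_rfl
    | succ j _ ihj => exact fun hj => (ihj (by omega)).trans (hx j (by omega)).le
  have hsub : ∀ i < n, Icc (x i) (x (i + 1)) ⊆ Icc 0 1 := fun i hi =>
    Icc_subset_Icc (hx0 ▸ hmono 0 i (Nat.zero_le _) hi.le) (hx1 ▸ hmono (i + 1) n hi le_rfl)
  set g : ℕ → ℝ → ℝ := fun j => iteratedDerivWithin j u (Icc 0 1) with hg
  have hg0 : g 0 = u := by simp [hg]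
  have hgd : ∀ j ≤ k, ∀ y ∈ Icc (0 : ℝ) 1, HasDerivWithinAt (g j) (g (j + 1) y) (Icc 0 1) y :=
    fun j hj y hy => hasDerivWithinAt_iteratedDerivWithin hs hu (by omega) hy
  have hgc : ContinuousOn (g (k + 1)) (Icc 0 1) :=
    hu.continuousOn_iteratedDerivWithin le_rfl hs
  have hex := fun i (hi : i < n) => exists_cell_interpolant (hx i hi) hk g
    (fun j hj y hy => (hgd j hj y (hsub i hi hy)).mono (hsub i hi)) (hgc.mono (hsub i hi))
  choose! p hpd hpa hpb hp₀ hp₁ using hex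
  obtain ⟨v, hvc, hv⟩ := exists_glue hn hx (P := fun i y => (p i).eval y)
    (fun i => (p i).continuous) (fun i hi => by rw [hpb i (by omega), hpa (i + 1) hi])
  rw [hx0, hx1] at hvc
  have hv' : IsPiecewiseC1 v := isPiecewiseC1_of_polynomial hn hx0 hx1 hvc
    fun i hi => ⟨p i, hv i hi⟩
  have he := hu'.sub hv'
  have hcell : ∀ i < n, uIcc (x i) (x (i + 1)) ⊆ uIcc 0 1 := fun i hi => by
    rw [uIcc_of_le (hx i hi).le, uIcc_of_le zero_le_one]; exact hsub i hi
  -- Summation over cells, shared by both error norms: `r` is the power of the cell length, and the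
  -- global majorant `G` absorbs the varying lengths.
  have sum_le : ∀ {φ G : ℝ → ℝ} {r : ℕ}, IntervalIntegrable φ MeasureTheory.volume 0 1 →
      ContinuousOn G (Icc 0 1) →
      (∀ i < n, ∫ y in x i..x (i + 1), φ y ≤
        (x (i + 1) - x i) ^ r * ∫ y in x i..x (i + 1), g (k + 1) y ^ 2) →
      (∀ i < n, ∀ y ∈ Icc (x i) (x (i + 1)), (x (i + 1) - x i) ^ r * g (k + 1) y ^ 2 ≤ G y) →
      ∫ y in (0 : ℝ)..1, φ y ≤ ∫ y in (0 : ℝ)..1, G y := by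
    intro φ G r hφ hG hφi hGi
    have hGint : IntervalIntegrable G MeasureTheory.volume 0 1 :=
      hG.intervalIntegrable_of_Icc zero_le_one
    have e1 := intervalIntegral.sum_integral_adjacent_intervals
      (fun i hi => hφ.mono_set (hcell i hi))
    have e2 := intervalIntegral.sum_integral_adjacent_intervals
      (fun i hi => hGint.mono_set (hcell i hi))
    rw [hx0, hx1] at e1 e2
    rw [← e1, ← e2]
    refine Finset.sum_le_sum fun i hi => ?_
    rw [Finset.mem_range] at hi
    have hc2 : ContinuousOn (fun y => (x (i + 1) - x i) ^ r * g (k + 1) y ^ 2)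
        (Icc (x i) (x (i + 1))) :=
      continuousOn_const.mul ((hgc.mono (hsub i hi)).pow 2)
    refine (hφi i hi).trans ?_
    rw [← intervalIntegral.integral_const_mul]
    exact intervalIntegral.integral_mono_on (hx i hi).le
      (hc2.intervalIntegrable_of_Icc (hx i hi).le) (hGint.mono_set (hcell i hi)) (hGi i hi)
  refine ⟨v, hvc, fun i hi => ⟨p i, hpd i hi, hv i hi⟩, ?_, ?_⟩
  · refine sum_le (r := 2 * k + 2)
      ((he.cont.pow 2).intervalIntegrable_of_Icc zero_le_one) hG₀ (fun i hi => ?_) h₀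
    refine le_trans (le_of_eq ?_) (hp₀ i hi)
    refine intervalIntegral.integral_congr fun y hy => ?_
    rw [uIcc_of_le (hx i hi).le] at hy
    simp only [hg0, hv i hi y hy]
  · have hint : IntervalIntegrable (fun y => deriv (fun y => u y - v y) y ^ 2)
        MeasureTheory.volume 0 1 := by
      simpa only [sq] using he.intervalIntegrable_deriv_mul_deriv he
    refine sum_le (r := 2 * k) hint hG₁ (fun i hi => ?_) h₁
    refine le_trans (le_of_eq ?_) (hp₁ i hi)
    refine intervalIntegral.integral_congr_Ioo_of_le (hx i hi).le fun y hy => ?_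
    have hy' := Ioo_subset_Icc_self hy
    have hgy : HasDerivAt u (g 1 y) y := by
      have := (hgd 0 (Nat.zero_le _) y (hsub i hi hy')).mono (hsub i hi)
      rw [hg0] at this
      exact this.hasDerivAt (Icc_mem_nhds hy.1 hy.2)
    have hve : v =ᶠ[nhds y] fun y => (p i).eval y := by
      filter_upwards [Icc_mem_nhds hy.1 hy.2] with z hz using hv i hi z hz
    have hvy := ((p i).hasDerivAt y).congr_of_eventuallyEq hve
    have := (hgy.sub hvy).deriv
    change deriv (fun y => u y - v y) y = _ at this
    simp only [this]

/-! ### Scaling of the transition point and size of the layer -/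

theorem transition_pos {ε : ℝ} (hε : 0 < ε) (k : ℕ) : 0 < transition ε k :=
  Real.rpow_pos_of_pos hε _

theorem lt_one_of_transition {ε : ℝ} {k : ℕ} (hk : 2 ≤ k)
    (h : 2 * transition ε k < 1) : ε < 1 := by
  by_contra! h1
  have hk' : (2 : ℝ) ≤ k := by exact_mod_cast hk
  have : 1 ≤ transition ε k := Real.one_le_rpow h1 (div_nonneg (by linarith) (by linarith))
  linarith

theorem transition_pow {ε : ℝ} {k : ℕ} (hε : 0 < ε) (hk : 2 ≤ k) :
    transition ε k ^ k = ε ^ (k - 1) := by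
  have hk' : (k : ℝ) ≠ 0 := by positivity
  rw [transition, ← Real.rpow_natCast, ← Real.rpow_mul hε.le, div_mul_cancel₀ _ hk',
    ← Real.rpow_natCast, Nat.cast_sub (by omega), Nat.cast_one]

/-- Taking `k`-th powers turns this into `ε^{2(k-1)} ≤ ε^k`, which is where `k ≥ 2` enters. -/
theorem transition_sq_le {ε : ℝ} {k : ℕ} (hε : 0 < ε) (hε1 : ε < 1) (hk : 2 ≤ k) :
    transition ε k ^ 2 ≤ ε := by
  have h : (transition ε k ^ 2) ^ k ≤ ε ^ k := by
    rw [← pow_mul, mul_comm, pow_mul, transition_pow hε hk, ← pow_mul]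
    exact pow_le_pow_of_le_one hε.le hε1.le (by omega)
  exact le_of_pow_le_pow_left₀ (by omega) hε.le h

/-- Outside the layer regions the layer function is smaller than any power needed. -/
theorem layer_div_le {ε x : ℝ} {k : ℕ} (hε : 0 < ε) (hk : 2 ≤ k)
    (hx : x ∈ Icc (transition ε k) (1 - transition ε k)) :
    layer ε x / ε ^ k ≤ 2 * (k * k).factorial := by
  set t := transition ε k with ht
  have ht0 : 0 < t := transition_pos hε k
  have h1 : layer ε x ≤ 2 * Real.exp (-(t / ε)) := by
    have e1 : Real.exp (-(x / ε)) ≤ Real.exp (-(t / ε)) := by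
      gcongr; exact hx.1
    have e2 : Real.exp (-((1 - x) / ε)) ≤ Real.exp (-(t / ε)) := by
      gcongr; linarith [hx.2]
    unfold layer; linarith
  have h2 : (t / ε) ^ k = 1 / ε := by
    rw [div_pow, ht, transition_pow hε hk]
    obtain ⟨m, rfl⟩ : ∃ m, k = m + 1 := ⟨k - 1, by omega⟩
    rw [Nat.add_sub_cancel, pow_succ]
    field_simp
  -- Since `(τ/ε)^k = 1/ε`, the exponential series term of degree `k * k` yields exactly `ε^{-k}`.
  have h3 := Real.pow_div_factorial_le_exp (t / ε) (by positivity) (k * k)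
  rw [pow_mul, h2, div_pow, one_pow, div_le_iff₀ (by positivity)] at h3
  calc layer ε x / ε ^ k = layer ε x * (1 / ε ^ k) := by ring
    _ ≤ 2 * Real.exp (-(t / ε)) * (Real.exp (t / ε) * (k * k).factorial) := by gcongr
    _ = 2 * (k * k).factorial * (Real.exp (-(t / ε)) * Real.exp (t / ε)) := by ring
    _ = 2 * (k * k).factorial := by rw [← Real.exp_add]; simp

theorem continuous_layer (ε : ℝ) : Continuous (layer ε) := by
  unfold layer; fun_prop

/-- On `[0,1]` the layer is at most `2`, so its square is at most twice itself, and its integral is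
at most `2 ε`. -/
theorem integral_layer_sq_le {ε : ℝ} (hε : 0 < ε) :
    ∫ x in (0 : ℝ)..1, layer ε x ^ 2 ≤ 4 * ε := by
  have h1 : ∫ x in (0 : ℝ)..1, layer ε x / ε = _ :=
    intervalIntegral.integral_eq_sub_of_hasDerivAt
      (fun x _ => hasDerivAt_deriv_layerWeight (ε := ε) x)
      (((continuous_layer ε).div_const ε).intervalIntegrable 0 1)
  have h2 : ∫ x in (0 : ℝ)..1, layer ε x / ε ≤ 2 := by
    rw [h1]
    simp only [sub_self, zero_div, neg_zero, Real.exp_zero, sub_zero]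
    linarith [Real.exp_pos (-(1 / ε))]
  have h3 : ∫ x in (0 : ℝ)..1, layer ε x ^ 2 ≤ ∫ x in (0 : ℝ)..1, 2 * ε * (layer ε x / ε) := by
    refine intervalIntegral.integral_mono_on zero_le_one
      (((continuous_layer ε).pow 2).intervalIntegrable 0 1)
      ((continuous_const.mul ((continuous_layer ε).div_const ε)).intervalIntegrable 0 1)
      fun x hx => ?_
    have e0 := layer_pos ε x
    have e1 : layer ε x ≤ 2 := by
      have : Real.exp (-(x / ε)) ≤ 1 := Real.exp_le_one_iff.2 (by
        have := div_nonneg hx.1 hε.le; linarith)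
      have : Real.exp (-((1 - x) / ε)) ≤ 1 := Real.exp_le_one_iff.2 (by
        have := div_nonneg (sub_nonneg.2 hx.2) hε.le; linarith)
      unfold layer; linarith
    have e2 : 2 * ε * (layer ε x / ε) = 2 * layer ε x := by field_simp
    rw [e2]
    nlinarith
  rw [intervalIntegral.integral_const_mul] at h3
  nlinarith

/-- The weight bounding the derivative of order `k + 1` of the solution has `L²` norm of the
order of that of the boundary layer. -/
theorem integral_weight_sq_le {ε : ℝ} {k : ℕ} (hε : 0 < ε) (hε1 : ε < 1) (hk : 1 ≤ k) :
    ∫ x in (0 : ℝ)..1, (1 + layer ε x / ε ^ k) ^ 2 ≤ 10 * (ε / ε ^ (2 * k)) := by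
  have hc := continuous_layer ε
  have h1 : ∫ x in (0 : ℝ)..1, (1 + layer ε x / ε ^ k) ^ 2 ≤
      ∫ x in (0 : ℝ)..1, (2 + 2 / ε ^ (2 * k) * layer ε x ^ 2) := by
    refine intervalIntegral.integral_mono_on zero_le_one
      (Continuous.intervalIntegrable (by fun_prop) 0 1)
      (Continuous.intervalIntegrable (by fun_prop) 0 1) fun x _ => ?_
    have e1 : 2 / ε ^ (2 * k) * layer ε x ^ 2 = 2 * (layer ε x / ε ^ k) ^ 2 := by
      rw [div_pow, ← pow_mul, mul_comm k 2]; ring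
    rw [e1]
    nlinarith [sq_nonneg (1 - layer ε x / ε ^ k)]
  rw [intervalIntegral.integral_add (by simp)
    (Continuous.intervalIntegrable (by fun_prop) 0 1), intervalIntegral.integral_const_mul] at h1
  simp only [intervalIntegral.integral_const, sub_zero, one_smul] at h1
  have h2 : 2 / ε ^ (2 * k) * ∫ x in (0 : ℝ)..1, layer ε x ^ 2 ≤ 8 * (ε / ε ^ (2 * k)) :=
    calc _ ≤ 2 / ε ^ (2 * k) * (4 * ε) := by
          gcongr; exact integral_layer_sq_le hε
      _ = _ := by ring
  -- Absorbs the contribution `2` of the constant part into the layer term, giving `8 + 2 = 10`.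
  have h3 : 1 ≤ ε / ε ^ (2 * k) := by
    rw [one_le_div (by positivity)]
    simpa using pow_le_pow_of_le_one hε.le hε1.le (show 1 ≤ 2 * k by omega)
  linarith

/-! ### Interpolation error on the layer-adapted mesh -/

/-- Interpolation error of the solution on the layer-adapted mesh. -/
theorem exists_feSpace_interpolant {k N M : ℕ} {ε H A α : ℝ} {u : ℝ → ℝ} (hk : 2 ≤ k) (hε : 0 < ε)
    (hε1 : 2 * transition ε k < 1) (hH : 0 < H) (hN : 0 < N) (hM : 0 < M) (hα : 0 < α)
    (hh : transition ε k / N ≤ α * H * transition ε k)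
    (hHM : (1 - 2 * transition ε k) / M ≤ H)
    (hu : ContDiffOn ℝ (k + 1 : ℕ) u (Icc 0 1)) (hu' : IsPiecewiseC1 u)
    (hub : ∀ x ∈ Icc (0 : ℝ) 1,
      |iteratedDerivWithin (k + 1) u (Icc 0 1) x| ≤ A * (1 + layer ε x / ε ^ k)) :
    ∃ v ∈ feSpace k (transition ε k) N M,
      ∫ y in (0 : ℝ)..1, (u y - v y) ^ 2 ≤
        A ^ 2 * (10 * α ^ (2 * k + 2) + (1 + 2 * (k * k).factorial) ^ 2) * H ^ (2 * k + 2) ∧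
      ε ^ 2 * ∫ y in (0 : ℝ)..1, deriv (fun y => u y - v y) y ^ 2 ≤
        A ^ 2 * (10 * α ^ (2 * k) + (1 + 2 * (k * k).factorial) ^ 2) * (ε * H ^ (2 * k)) := by
  set t := transition ε k with ht
  have ht0 : 0 < t := transition_pos hε k
  have hεl : ε < 1 := lt_one_of_transition hk hε1
  set F : ℝ := 1 + 2 * (k * k).factorial with hF
  have hF0 : 0 ≤ F := by positivity
  have hw0 : ∀ x, 0 ≤ 1 + layer ε x / ε ^ k := fun x => by
    have := layer_pos ε x; positivity
  have hc := continuous_layer ε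
  have htN : 0 < t / N := by positivity
  -- the local majorant for the power `r` of the mesh size
  have hloc : ∀ r : ℕ, ∀ i < 2 * N + M,
      ∀ y ∈ Icc (meshNode t N M i) (meshNode t N M (i + 1)),
      (meshNode t N M (i + 1) - meshNode t N M i) ^ r *
        iteratedDerivWithin (k + 1) u (Icc 0 1) y ^ 2 ≤
      A ^ 2 * ((α * H * t) ^ r * (1 + layer ε y / ε ^ k) ^ 2 + H ^ r * F ^ 2) := by
    intro r i hi y hy
    have hy01 : y ∈ Icc (0 : ℝ) 1 := by
      have hm := strictMono_nat_of_lt_succ (meshNode_lt hN hM ht0 hε1)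
      rw [← meshNode_zero (τ := t) (N := N) (M := M), ← meshNode_last (τ := t) hN hM]
      exact ⟨(hm.monotone (Nat.zero_le i)).trans hy.1, hy.2.trans (hm.monotone hi)⟩
    have hD : iteratedDerivWithin (k + 1) u (Icc 0 1) y ^ 2 ≤
        A ^ 2 * (1 + layer ε y / ε ^ k) ^ 2 := by
      rw [← sq_abs, ← mul_pow]
      exact pow_le_pow_left₀ (abs_nonneg _) (hub y hy01) 2
    -- Short cells keep the full weight; middle cells replace it by the constant `F`. Adding both
    -- majorants gives one continuous function valid on every cell.
    rcases meshNode_cell hN hM hε1 i with h | ⟨h, hsub⟩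
    · rw [h]
      have e1 : (t / N) ^ r ≤ (α * H * t) ^ r := pow_le_pow_left₀ htN.le hh r
      have e2 : 0 ≤ A ^ 2 * (H ^ r * F ^ 2) := by positivity
      have e3 := mul_le_mul e1 hD (sq_nonneg _) (by positivity)
      linarith
    · rw [h]
      have e0 : 0 ≤ (1 - 2 * t) / M := div_nonneg (by linarith) (Nat.cast_nonneg M)
      have e1 : ((1 - 2 * t) / M) ^ r ≤ H ^ r := pow_le_pow_left₀ e0 hHM r
      have e2 : 0 ≤ A ^ 2 * ((α * H * t) ^ r * (1 + layer ε y / ε ^ k) ^ 2) := by positivity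
      have e4 : (1 + layer ε y / ε ^ k) ^ 2 ≤ F ^ 2 :=
        pow_le_pow_left₀ (hw0 y) (by linarith [layer_div_le hε hk (hsub hy)]) 2
      have e5 := hD.trans (mul_le_mul_of_nonneg_left e4 (sq_nonneg A))
      have e3 := mul_le_mul e1 e5 (sq_nonneg _) (by positivity)
      linarith
  have hint : ∀ r : ℕ, ∫ y in (0 : ℝ)..1,
      A ^ 2 * ((α * H * t) ^ r * (1 + layer ε y / ε ^ k) ^ 2 + H ^ r * F ^ 2) ≤
      A ^ 2 * ((α * H * t) ^ r * (10 * (ε / ε ^ (2 * k))) + H ^ r * F ^ 2) := by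
    intro r
    rw [intervalIntegral.integral_const_mul, intervalIntegral.integral_add
      (Continuous.intervalIntegrable (by fun_prop) 0 1) (by simp),
      intervalIntegral.integral_const_mul]
    simp only [intervalIntegral.integral_const, sub_zero, one_smul]
    have := integral_weight_sq_le hε hεl (show 1 ≤ k by omega)
    gcongr
  obtain ⟨v, hvc, hvp, hv₀, hv₁⟩ := exists_piecewise_interpolant (k := k) (n := 2 * N + M)
    (by omega) (by omega) meshNode_zero (meshNode_last hN hM)
    (fun i _ => meshNode_lt hN hM ht0 hε1 i) hu hu'
    (by fun_prop) (by fun_prop) (hloc (2 * k + 2)) (hloc (2 * k))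
  -- This cancels the `ε^{-2k}` of the layer, leaving `ε⁻²` against the weight `ε²` of the
  -- derivative term.
  have htk : t ^ (2 * k) = ε ^ (2 * k) / ε ^ 2 := by
    rw [mul_comm, pow_mul, transition_pow hε hk, ← pow_mul]
    have : ε ^ (k * 2) = ε ^ ((k - 1) * 2) * ε ^ 2 := by rw [← pow_add]; congr 1; omega
    rw [this]
    field_simp
  refine ⟨v, ⟨hvc, hvp⟩, (hv₀.trans (hint _)).trans ?_, ?_⟩
  · have e1 : (α * H * t) ^ (2 * k + 2) * (10 * (ε / ε ^ (2 * k))) =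
        10 * α ^ (2 * k + 2) * H ^ (2 * k + 2) * (t ^ 2 / ε) := by
      rw [mul_pow, mul_pow, pow_add t, htk]
      field_simp
    have e2 : t ^ 2 / ε ≤ 1 := (div_le_one hε).2 (transition_sq_le hε hεl hk)
    have e3 : 10 * α ^ (2 * k + 2) * H ^ (2 * k + 2) * (t ^ 2 / ε) ≤
        10 * α ^ (2 * k + 2) * H ^ (2 * k + 2) := mul_le_of_le_one_right (by positivity) e2
    rw [e1]
    have := mul_le_mul_of_nonneg_left e3 (sq_nonneg A)
    linarith
  · have e1 : ε ^ 2 * (A ^ 2 * ((α * H * t) ^ (2 * k) * (10 * (ε / ε ^ (2 * k))) +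
        H ^ (2 * k) * F ^ 2)) =
        A ^ 2 * (10 * α ^ (2 * k) * (ε * H ^ (2 * k)) + ε ^ 2 * (H ^ (2 * k) * F ^ 2)) := by
      rw [mul_pow, mul_pow, htk]
      field_simp
    have e2 : ε ^ 2 * (H ^ (2 * k) * F ^ 2) ≤ ε * (H ^ (2 * k) * F ^ 2) := by
      gcongr; nlinarith
    have e3 := mul_le_mul_of_nonneg_left (hv₁.trans (hint _)) (sq_nonneg ε)
    rw [e1] at e3
    have := mul_le_mul_of_nonneg_left e2 (sq_nonneg A)
    linarith

end LayerFEM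

/-! ### Assembly of the error estimate -/

theorem mainTheorem4 (k : ℕ) (hk : 2 ≤ k) :
    ∃ m : ℕ, ∀ c f : ℝ → ℝ,
      ContDiffOn ℝ m c (Set.Icc 0 1) → ContDiffOn ℝ m f (Set.Icc 0 1) →
      (∀ x ∈ Set.Icc (0 : ℝ) 1, 1 < c x) →
      ∀ α : ℝ, 0 < α →
      ∃ C : ℝ, 0 < C ∧
        ∀ (ε H : ℝ) (N M : ℕ),
          0 < ε → 2 * LayerFEM.transition ε k < 1 → 0 < H → 0 < N → 0 < M →
          LayerFEM.transition ε k / N ≤ α * H * ε ^ (((k : ℝ) - 1) / (k : ℝ)) →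
          (1 - 2 * LayerFEM.transition ε k) / M ≤ H →
          ∀ u uh : ℝ → ℝ,
            LayerFEM.IsNeumannSolution ε c f u →
            LayerFEM.IsGalerkinSolution ε c f
              (LayerFEM.feSpace k (LayerFEM.transition ε k) N M) uh →
            LayerFEM.energyNorm ε (fun x => u x - uh x) ≤
              C * (ε ^ ((1 : ℝ) / 2) * H ^ k + H ^ (k + 1)) := by
  -- `k + 1` derivatives for interpolation, plus two for each of the `k` expansion steps.
  refine ⟨k + 1 + 2 * k, fun c f hc hf hc1 α hα => ?_⟩
  obtain ⟨A, hA, hbound⟩ := LayerFEM.exists_iteratedDerivWithin_bound (by omega) hc hf hc1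
  obtain ⟨B, hB⟩ := isCompact_Icc.exists_bound_of_continuousOn hc.continuousOn
  replace hB : ∀ x ∈ Icc (0 : ℝ) 1, c x ≤ B := fun x hx => (le_abs_self _).trans (hB x hx)
  have hB0 : 0 ≤ B := by linarith [hB 0 (by simp), hc1 0 (by simp)]
  set C₀ : ℝ := A ^ 2 * (10 * α ^ (2 * k + 2) + (1 + 2 * (k * k).factorial) ^ 2) with hC₀
  set C₁ : ℝ := A ^ 2 * (10 * α ^ (2 * k) + (1 + 2 * (k * k).factorial) ^ 2) with hC₁
  have hC₀0 : 0 ≤ C₀ := by positivity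
  have hC₁0 : 0 ≤ C₁ := by positivity
  -- The summand `1` ensures `D ≤ D²`, so that the squared error is at most the square of `D (P +
  -- Q)`.
  set D : ℝ := C₁ + B * C₀ + 1 with hD
  have hBC : 0 ≤ B * C₀ := mul_nonneg hB0 hC₀0
  have hD1 : 1 ≤ D := by linarith
  refine ⟨2 * D, by linarith, fun ε H N M hε hτ hH hN hM hh hHM u uh hu huh => ?_⟩
  obtain ⟨hup, hub⟩ := hbound ε hε (LayerFEM.lt_one_of_transition hk hτ) u hu
  obtain ⟨v, hv, hv₀, hv₁⟩ := LayerFEM.exists_feSpace_interpolant hk hε hτ hH hN hM hα hh hHM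
    hup hu.isPiecewiseC1 hub
  have hcea := huh.error_le hε hu hc.continuousOn hf.continuousOn hc1 hB
    (fun w hw => LayerFEM.isPiecewiseC1_of_mem_feSpace hN hM hw)
    (fun w hw z hz => LayerFEM.sub_mem_feSpace hw hz) hv
  set P := ε ^ ((1 : ℝ) / 2) * H ^ k with hP
  have hP0 : 0 ≤ P := by positivity
  set Q := H ^ (k + 1) with hQ
  have hQ0 : 0 ≤ Q := by positivity
  have hP2 : ε * H ^ (2 * k) = P ^ 2 := by
    rw [hP, mul_pow, ← Real.sqrt_eq_rpow, Real.sq_sqrt hε.le, ← pow_mul, mul_comm k 2]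
  have hQ2 : H ^ (2 * k + 2) = Q ^ 2 := by
    rw [hQ, ← pow_mul]; congr 1; ring
  rw [hP2] at hv₁
  rw [hQ2] at hv₀
  have hBv := mul_le_mul_of_nonneg_left hv₀ hB0
  have hfin := LayerFEM.energyNorm_le (X := D * (P + Q)) (v := fun x => u x - uh x) hε
    (by positivity) (by
      refine hcea.trans ((add_le_add hv₁ hBv).trans ?_)
      have e1 : C₁ * P ^ 2 ≤ D * P ^ 2 := by gcongr; linarith
      have e2 : B * C₀ * Q ^ 2 ≤ D * Q ^ 2 := by gcongr; linarith
      have e3 : D * (P ^ 2 + Q ^ 2) ≤ D ^ 2 * (P + Q) ^ 2 :=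
        mul_le_mul (by nlinarith) (by nlinarith [mul_nonneg hP0 hQ0]) (by positivity)
          (by positivity)
      rw [mul_pow]
      linarith)
  linarith
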